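/- Let $n\ge 1$. Let $\mathscr{M}_+(\mathbb{R}^n)$ be the set of positive locally finite Borel measures on $\mathbb{R}^n$, with the smallest $\sigma$-algebra for which $p\mapsto p(B)$ is measurable for every Borel set $B$. A random measure on $\mathbb{R}^n$ is a probability measure $\mu$ on $\mathscr{M}_+(\mathbb{R}^n)$; it is invariant if it is preserved by push-forward under all translations of $\mathbb{R}^n$, and locally square-integrable if $\int p(B)^2\,d\mu(p)<\infty$ for every bounded Borel set $B$. For a bounded measurable function $f:\mathbb{R}^n\to\mathbb{C}$ with bounded support put $Sf(p)=\int f\,dp$ and $\hat f(\xi)=\int_{\mathbb{R}^n} f(x)e^{-i\langle x,\xi\rangle}\,dx$. The number variance of $\mu$ is $\mathrm{NV}_\mu(r)=\mathrm{Var}_\mu(p(B_r))$, where $B_r$ is the Euclidean ball of radius $r$ centred at the origin. A diffraction measure of $\mu$ is a positive Radon measure $\hat\eta_\mu$ on $\mathbb{R}^n$ such that, for all bounded measurable $f_1,f_2$ with bounded support, $\hat f_1,\hat f_2\in L^2(\hat\eta_\mu)$ and $$\mathrm{Cov}_\mu(Sf_1,Sf_2)=\int_{\mathbb{R}^n}\hat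 f_1(\xi)\,\overline{\hat f_2(\xi)}\,d\hat\eta_\mu(\xi).$$ Theorem. For every $n\ge1$ there is a constant $C=C(n)>0$ such that every invariant, locally square-integrable random measure $\mu$ on $\mathbb{R}^n$ has exactly one diffraction measure $\hat\eta_\mu$, and for every $R_0>0$ the integral $\int_{\|\xi\|\ge 1/R_0}\|\xi\|^{-(n+1)}\,d\hat\eta_\mu(\xi)$ is finite and, for every $R\ge R_0$, the function $\mathrm{NV}_\mu$ is integrable on $[0,R]$ and $$\frac1R\int_0^R \mathrm{NV}_\mu(r)\,dr\;\ge\; C\left(\int_{\|\xi\|\ge 1/R_0}\frac{d\hat\eta_\mu(\xi)}{\|\xi\|^{n+1}}\right)R^{n-1}.$$ -/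

import Mathlib

open MeasureTheory ProbabilityTheory
open scoped ComplexConjugate

noncomputable section

namespace RandomMeasure

/-- Euclidean space `ℝⁿ`. -/
abbrev Euc (n : ℕ) : Type := EuclideanSpace ℝ (Fin n)

/-- The cone `𝓜₊(ℝⁿ)` of positive locally finite Borel measures on `ℝⁿ`. Its σ-algebra is the one
inherited from `Measure (Euc n)`: the smallest for which `p ↦ p B` is measurable for every Borel
set `B` (equivalently, for bounded `B` only, or for which all linear statistics are measurable). -/
abbrev LocFinMeasure (n : ℕ) : Type := {p : Measure (Euc n) // IsLocallyFiniteMeasure p}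

/-- The translate `v_* p` of a locally finite measure by a vector `v`. -/
def translateMeasure {n : ℕ} (v : Euc n) (p : LocFinMeasure n) : LocFinMeasure n :=
  ⟨p.1.map (fun x => v + x), by
    have := p.2
    refine ⟨fun x => ?_⟩
    obtain ⟨U, hU, hfin⟩ := p.1.finiteAt_nhds (-v + x)
    refine ⟨(fun y => -v + y) ⁻¹' U, (continuous_const_add (-v)).continuousAt hU, ?_⟩
    rw [← MeasurableEquiv.coe_addLeft, MeasurableEquiv.map_apply]
    simpa [Set.preimage_preimage] using hfin⟩

/-- A random measure is a (probability) measure `μ` on `𝓜₊(ℝⁿ)`; it is invariant if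
`v_* μ = μ` for every translation `v`. -/
def IsInvariant {n : ℕ} (μ : Measure (LocFinMeasure n)) : Prop :=
  ∀ v : Euc n, μ.map (translateMeasure v) = μ

/-- Local square-integrability: `∫ p(B)² dμ(p) < ∞` for every bounded Borel set `B`. -/
def IsLocallySquareIntegrable {n : ℕ} (μ : Measure (LocFinMeasure n)) : Prop :=
  ∀ B : Set (Euc n), MeasurableSet B → Bornology.IsBounded B →
    ∫⁻ p, (p.1 B) ^ 2 ∂μ < ⊤

/-- The space of bounded measurable functions `ℝⁿ → ℂ` vanishing outside a bounded set. -/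
structure IsBoundedlySupported {n : ℕ} (f : Euc n → ℂ) : Prop where
  measurable : Measurable f
  bounded : ∃ M : ℝ, ∀ x, ‖f x‖ ≤ M
  support : Bornology.IsBounded (Function.support f)

/-- The linear statistic `Sf(p) = ∫ f dp`. -/
def linearStatistic {n : ℕ} (f : Euc n → ℂ) (p : LocFinMeasure n) : ℂ :=
  ∫ x, f x ∂p.1

/-- The covariance `Cov_μ(Sf, Sg) = 𝔼[(Sf - 𝔼 Sf) * conj (Sg - 𝔼 Sg)]` of two linear
statistics. -/
def statCov {n : ℕ} (μ : Measure (LocFinMeasure n)) (f g : Euc n → ℂ) : ℂ :=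
  ∫ p, (linearStatistic f p - ∫ q, linearStatistic f q ∂μ) *
    conj (linearStatistic g p - ∫ q, linearStatistic g q ∂μ) ∂μ

/-- The number variance `NV_μ(r)`: the variance of `p ↦ p(B_r)`, with `B_r` the ball of radius
`r` centred at the origin. -/
def numberVariance {n : ℕ} (μ : Measure (LocFinMeasure n)) (r : ℝ) : ℝ :=
  variance (fun p : LocFinMeasure n => p.1.real (Metric.ball (0 : Euc n) r)) μ

/-- The Fourier transform `f̂(ξ) = ∫ f(x) exp(-i⟨x, ξ⟩) dx`. -/
def fourierTransform {n : ℕ} (f : Euc n → ℂ) (ξ : Euc n) : ℂ :=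
  ∫ x, f x * Complex.exp (-(Complex.I * ((inner ℝ x ξ : ℝ) : ℂ)))

/-- `η` is a diffraction measure of `μ`: a positive Radon (i.e. locally finite Borel) measure on
`ℝⁿ` such that, for all bounded measurable `f, g` with bounded support, `f̂ ∈ L²(η)` and
`Cov_μ(Sf, Sg) = ∫ f̂ conj(ĝ) dη`. -/
structure IsDiffractionMeasure {n : ℕ} (μ : Measure (LocFinMeasure n))
    (η : Measure (Euc n)) : Prop where
  locallyFinite : IsLocallyFiniteMeasure η
  memLp : ∀ f : Euc n → ℂ, IsBoundedlySupported f → MemLp (fourierTransform f) 2 η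
  cov_eq : ∀ f g : Euc n → ℂ, IsBoundedlySupported f → IsBoundedlySupported g →
    statCov μ f g = ∫ ξ, fourierTransform f ξ * conj (fourierTransform g ξ) ∂η

end RandomMeasure

end

/-! ### Bochner's theorem for stationary kernels in a Hilbert space. -/

section Bochner

open Filter Topology Complex Real FourierTransform

variable {V : Type*} [NormedAddCommGroup V] [InnerProductSpace ℝ V] [MeasurableSpace V]
  [BorelSpace V] [FiniteDimensional ℝ V]

/-! Existence of the diffraction measure is a spectral argument. By invariance, the covariance of
two translates of a statistic `Sf` depends only on the difference of the translation vectors, and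
the centred translates move continuously in `L²(μ)` (`continuous_centeredStat_shift`). Bochner's
theorem (`exists_charFun_eq_of_stationary`) therefore gives a finite spectral measure `m_f`.
Computing the covariances of translates of `f * g` in two ways gives `|ĝ|² m_f = |f̂|² m_g`
(`withDensity_spectralWeight_comm`). So with one window `w` whose transform never vanishes, `η =
|ŵ|⁻² m_w` satisfies `|f̂|² η = m_f` for every `f`. This is the covariance formula on the diagonal,
and polarization gives the rest. Uniqueness uses the same window: the characteristic function of
`|ŵ|² η` is prescribed by the covariances, and the density can be divided out.

For the lower bound put `n = m + 1`. The variance `NV(r)` is the `η`-integral of the squared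
transform of the ball of radius `r`, which at `ξ` is `κ r^(m+1) j(r‖ξ‖)`, where `κ` is the volume of
the unit ball of `ℝᵐ` and `j` is `sphericalCos m`. After Tonelli, everything rests on the
one-variable estimate `∫₀ᵀ s^(2m+2) j(s)² ds ≥ C T^(m+1)` for `T ≥ 1`. Rescaled by `s = r‖ξ‖`, it
bounds the `r`-integral on `[0, R]` below by `C R^(m+1) ‖ξ‖^-(m+2)` as soon as `R‖ξ‖ ≥ 1`, which
holds for all `R ≥ R₀` when `‖ξ‖ ≥ 1/R₀`.

The one-variable estimate needs no Bessel asymptotics. It follows from the equation `s j'' + (m+2)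
j' + s j = 0`: a corrected energy shows that `j² + j'²` has exact order `s^-(m+2)`
(`bessel_energy_bounds`), and an equipartition identity shows that `j²` carries about half of it on
average (`bessel_integral_sq_lower_bound`). -/

/-- An integrable continuous function with nonnegative Fourier transform has an integrable
Fourier transform. -/
theorem integrable_fourier_of_nonneg {f : V → ℂ} (hf : Integrable f) (hc : Continuous f)
    {q : V → ℝ} (hq : ∀ w, 0 ≤ q w) (hfq : ∀ w, 𝓕 f w = q w) : Integrable (𝓕 f) := by
  have hcont : Continuous (𝓕 f) :=
    VectorFourier.fourierIntegral_continuous Real.continuous_fourierChar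
      (by exact continuous_inner) hf
  have hqc : Continuous q := by
    have : q = fun w => (𝓕 f w).re := by ext w; simp [hfq]
    rw [this]; exact Complex.continuous_re.comp hcont
  have hbd : ∀ w, q w ≤ ∫ v, ‖f v‖ := fun w => by
    have h1 : ‖𝓕 f w‖ ≤ ∫ v, ‖f v‖ :=
      VectorFourier.norm_fourierIntegral_le_integral_norm _ _ _ _ _
    rw [hfq, Complex.norm_real, Real.norm_of_nonneg (hq w)] at h1
    exact h1
  have hgauss : ∀ c : ℝ, 0 < c → Integrable (fun w : V => rexp (-c⁻¹ * ‖w‖ ^ 2)) := by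
    intro c hc'
    have := (GaussianFourier.integrable_cexp_neg_mul_sq_norm_add (V := V) (b := (c⁻¹ : ℝ))
      (by simpa using hc') 0 0).re
    refine this.congr (ae_of_all _ fun w => ?_)
    have : (-((c⁻¹ : ℝ) : ℂ) * (‖w‖ : ℂ) ^ 2 + 0 * ((inner ℝ (0 : V) w : ℝ) : ℂ))
        = ((-c⁻¹ * ‖w‖ ^ 2 : ℝ) : ℂ) := by push_cast; ring
    simp only [this]
    exact Complex.exp_ofReal_re _
  have hint : ∀ c : ℝ, 0 < c → Integrable (fun w : V => rexp (-c⁻¹ * ‖w‖ ^ 2) * q w) := by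
    intro c hc'
    refine ((hgauss c hc').mul_const (∫ v, ‖f v‖)).mono'
      (Continuous.aestronglyMeasurable (by fun_prop)) (ae_of_all _ fun w => ?_)
    rw [Real.norm_of_nonneg (mul_nonneg (Real.exp_pos _).le (hq w))]
    gcongr
    exact hbd w
  -- Moving the Fourier transform from `f` onto the Gaussian turns this integral into `f` tested
  -- against an approximate identity at the origin.
  have hlim : Tendsto (fun c : ℝ => ∫ w : V, rexp (-c⁻¹ * ‖w‖ ^ 2) * q w) atTop
      (𝓝 (f 0).re) := by
    have h0 := Real.tendsto_integral_gaussian_smul' hf (v := 0) hc.continuousAt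
    have h1 := (Complex.continuous_re.tendsto _).comp h0
    refine h1.congr' ?_
    filter_upwards [Ioi_mem_atTop 0] with c (hc' : 0 < c)
    have J : Integrable (fun w : V ↦
        cexp (- c⁻¹ * ‖w‖ ^ 2 + 2 * π * I * ((inner ℝ (0 : V) w : ℝ) : ℂ))) :=
      GaussianFourier.integrable_cexp_neg_mul_sq_norm_add (by simpa) _ _
    have h2 := VectorFourier.integral_fourierIntegral_smul_eq_flip (L := innerₗ V)
      Real.continuous_fourierChar continuous_inner J hf
    have h3 : ∀ w : V, 𝓕 (fun w : V ↦ cexp (- c⁻¹ * ‖w‖ ^ 2 +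
        2 * π * I * ((inner ℝ (0 : V) w : ℝ) : ℂ))) w =
        (π * c : ℂ) ^ (Module.finrank ℝ V / 2 : ℂ) * cexp (-π ^ 2 * c * ‖0 - w‖ ^ 2) := by
      intro w
      rw [fourier_gaussian_innerProductSpace' (by simpa)]
      congr
      · simp
      · simp; ring
    have h4 : (∫ w : V, ((π * c : ℂ) ^ (Module.finrank ℝ V / 2 : ℂ) *
        cexp (-π ^ 2 * c * ‖0 - w‖ ^ 2)) • f w) =
        ∫ w : V, ((rexp (-c⁻¹ * ‖w‖ ^ 2) * q w : ℝ) : ℂ) := by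
      simp_rw [← h3]
      refine h2.trans (integral_congr_ae (ae_of_all _ fun w => ?_))
      have hflip : VectorFourier.fourierIntegral 𝐞 volume (innerₗ V).flip f w = 𝓕 f w := by
        rw [flip_innerₗ]; rfl
      simp only [hflip, hfq]
      push_cast
      simp
    simp only [Function.comp, h4]
    rw [integral_complex_ofReal, Complex.ofReal_re]
  -- Nonnegativity of `q` is what allows Fatou: the regularized integrals converge, so their limit
  -- bounds the unregularized one.
  have hfatou : ∫⁻ w, ENNReal.ofReal (q w) ≤ ENNReal.ofReal (f 0).re := by
    have hN : Tendsto (fun N : ℕ => ((N : ℝ) + 1)) atTop atTop :=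
      tendsto_atTop_add_const_right _ _ tendsto_natCast_atTop_atTop
    have h1 : ∀ w : V, ENNReal.ofReal (q w) = liminf (fun N : ℕ =>
        ENNReal.ofReal (rexp (-((N : ℝ) + 1)⁻¹ * ‖w‖ ^ 2) * q w)) atTop := by
      intro w
      refine (Tendsto.liminf_eq ?_).symm
      refine ENNReal.tendsto_ofReal ?_
      have : Tendsto (fun N : ℕ => rexp (-((N : ℝ) + 1)⁻¹ * ‖w‖ ^ 2) * q w) atTop
          (𝓝 (rexp (-0 * ‖w‖ ^ 2) * q w)) :=
        (((Real.continuous_exp.tendsto _).comp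
          (((tendsto_inv_atTop_zero.comp hN).neg).mul_const _))).mul_const _
      simpa using this
    simp_rw [h1]
    refine (lintegral_liminf_le (fun N => (Continuous.measurable (by fun_prop)).ennreal_ofReal)).trans ?_
    have h2 : ∀ N : ℕ, ∫⁻ w : V, ENNReal.ofReal (rexp (-((N : ℝ) + 1)⁻¹ * ‖w‖ ^ 2) * q w)
        = ENNReal.ofReal (∫ w : V, rexp (-((N : ℝ) + 1)⁻¹ * ‖w‖ ^ 2) * q w) := by
      intro N
      rw [ofReal_integral_eq_lintegral_ofReal (hint _ (by positivity))]
      exact ae_of_all _ fun w => mul_nonneg (Real.exp_pos _).le (hq w)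
    simp_rw [h2]
    exact (Tendsto.liminf_eq (ENNReal.tendsto_ofReal (hlim.comp hN))).le
  have hqi : Integrable q := by
    refine ⟨hqc.aestronglyMeasurable, ?_⟩
    rw [hasFiniteIntegral_iff_ofReal (ae_of_all _ hq)]
    exact hfatou.trans_lt ENNReal.ofReal_lt_top
  have : 𝓕 f = fun w => (q w : ℂ) := funext hfq
  rw [this]
  exact hqi.ofReal

/-- An integrable continuous function with nonnegative Fourier transform is the characteristic
function of a finite measure. -/
theorem exists_charFun_eq_of_fourier_nonneg {f : V → ℂ} (hf : Integrable f) (hc : Continuous f)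
    {q : V → ℝ} (hq : ∀ w, 0 ≤ q w) (hfq : ∀ w, 𝓕 f w = q w) :
    ∃ m : Measure V, IsFiniteMeasure m ∧ ∀ v, charFun m v = f v := by
  have hint := integrable_fourier_of_nonneg hf hc hq hfq
  have hinv := hc.fourierInv_fourier_eq hf hint
  have hcont : Continuous (𝓕 f) :=
    VectorFourier.fourierIntegral_continuous Real.continuous_fourierChar
      (by exact continuous_inner) hf
  have hqc : Continuous q := by
    have : q = fun w => (𝓕 f w).re := by ext w; simp [hfq]
    rw [this]; exact Complex.continuous_re.comp hcont
  have hqi : Integrable q := by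
    have : q = fun w => (𝓕 f w).re := by ext w; simp [hfq]
    rw [this]; exact hint.re
  have hfin : IsFiniteMeasure (volume.withDensity fun w : V => ENNReal.ofReal (q w)) :=
    isFiniteMeasure_withDensity_ofReal hqi.2
  -- Dilation by `2π` reconciles the kernel `e^{2πi⟨v,w⟩}` of Fourier inversion with the kernel
  -- `e^{i⟨v,w⟩}` of `charFun`.
  refine ⟨(volume.withDensity fun w : V => ENNReal.ofReal (q w)).map
    (fun x => (2 * π) • x), inferInstance, fun v => ?_⟩
  rw [charFun_map_smul, charFun_apply]
  have hwd : (volume.withDensity fun w : V => ENNReal.ofReal (q w)) =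
      volume.withDensity fun w : V => ((q w).toNNReal : ENNReal) := rfl
  rw [hwd, integral_withDensity_eq_integral_smul hqc.measurable.real_toNNReal, ← hinv,
    fourierInv_eq']
  refine integral_congr_ae (ae_of_all _ fun w => ?_)
  simp only [hfq, inner_smul_right, NNReal.smul_def, Real.coe_toNNReal _ (hq w), smul_eq_mul,
    Complex.real_smul]
  rw [mul_comm]

variable {H : Type*} [NormedAddCommGroup H] [InnerProductSpace ℂ H] [CompleteSpace H]

/-- Positivity of the Fourier transform of a Gaussian regularization of a stationary kernel. -/
theorem fourier_stationary_kernel_nonneg {φ : V → H} (hφ : Continuous φ) {k : V → ℂ}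
    (hk : ∀ v w, inner ℂ (φ v) (φ w) = k (v - w)) {ε : ℝ} (hε : 0 < ε) (ξ : V) :
    ∃ q : ℝ, 0 ≤ q ∧ 𝓕 (fun v => k v * cexp (-ε * ‖v‖ ^ 2)) ξ = q := by
  have hnorm : ∀ v, ‖φ v‖ = ‖φ 0‖ := by
    intro v
    have h1 := hk v v
    have h2 := hk 0 0
    rw [sub_self, inner_self_eq_norm_sq_to_K] at h1 h2
    rw [← h2] at h1
    have h3 : ‖φ v‖ ^ 2 = ‖φ 0‖ ^ 2 := by exact_mod_cast h1
    exact (pow_left_inj₀ (norm_nonneg _) (norm_nonneg _) two_ne_zero).1 h3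
  have hkeq : ∀ v, k v = inner ℂ (φ v) (φ 0) := fun v => by rw [hk, sub_zero]
  have hkc : Continuous k := by
    rw [funext hkeq]; exact hφ.inner continuous_const
  -- The squared norm of `∫ h u • φ u` is a double integral of `conj (h u) * h w * k (u - w)`. With
  -- `u = w + v`, the identity `2ε(‖w+v‖² + ‖w‖²) = 4ε‖w + v/2‖² + ε‖v‖²` separates the variables:
  -- the `w`-integral is the constant `c` below, and the `v`-integral is the transform to be shown
  -- nonnegative. This is why the Gaussian in `h` has parameter `2ε`.
  set h : V → ℂ := fun u => cexp (-(2 * ε : ℝ) * ‖u‖ ^ 2 + 2 * π * I * ((inner ℝ ξ u : ℝ) : ℂ))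
    with hh
  have hhi : Integrable h :=
    GaussianFourier.integrable_cexp_neg_mul_sq_norm_add (by simpa using hε) _ _
  have hhc : Continuous h := by rw [hh]; fun_prop
  have hhφ : Integrable (fun u => h u • φ u) := by
    refine (hhi.norm.mul_const ‖φ 0‖).mono' (hhc.smul hφ).aestronglyMeasurable
      (ae_of_all _ fun u => ?_)
    rw [norm_smul, hnorm]
  set F : V × V → ℂ := fun p => conj (h p.1) * h p.2 * k (p.1 - p.2) with hF
  have hFc : Continuous F := by
    have := hhc.comp (continuous_fst (X := V) (Y := V))
    have h2 := hhc.comp (continuous_snd (X := V) (Y := V))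
    exact ((Complex.continuous_conj.comp this).mul h2).mul
      (hkc.comp (continuous_fst.sub continuous_snd))
  have hFi : Integrable F (volume.prod volume) := by
    refine ((hhi.norm.mul_prod hhi.norm).mul_const (‖φ 0‖ * ‖φ 0‖)).mono'
      hFc.aestronglyMeasurable (ae_of_all _ fun p => ?_)
    simp only [hF, norm_mul, RCLike.norm_conj]
    gcongr
    rw [hkeq]
    exact (norm_inner_le_norm _ _).trans (by rw [hnorm])
  have h1 : inner ℂ (∫ u, h u • φ u) (∫ u, h u • φ u) = ∫ u, ∫ w, F (u, w) := by
    rw [← integral_inner hhφ]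
    have : ∀ w, inner ℂ (∫ u, h u • φ u) (h w • φ w) = ∫ u, F (u, w) := by
      intro w
      rw [← inner_conj_symm, ← integral_inner hhφ, ← integral_conj]
      refine integral_congr_ae (ae_of_all _ fun u => ?_)
      simp only [hF]
      rw [inner_conj_symm, inner_smul_left, inner_smul_right, hk]
      ring
    simp_rw [this]
    exact integral_integral_swap (f := fun w u => F (u, w)) hFi.swap
  have hshift : Integrable (fun p : V × V => F (p.1 + p.2, p.1)) (volume.prod volume) := by
    have := (measurePreserving_prod_add (volume : Measure V) (volume : Measure V))
    exact (this.integrable_comp_of_integrable hFi.swap)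
  set c : ℝ := ∫ w : V, rexp (-(4 * ε) * ‖w‖ ^ 2) with hcdef
  have hcpos : 0 < c := by
    rw [hcdef, GaussianFourier.integral_rexp_neg_mul_sq_norm (by positivity)]
    positivity
  have h2 : ∫ u, ∫ w, F (u, w) = c * 𝓕 (fun v => k v * cexp (-ε * ‖v‖ ^ 2)) ξ := by
    rw [integral_integral_swap (f := fun u w => F (u, w)) hFi]
    have e1 : ∀ w, ∫ u, F (u, w) = ∫ v, F (w + v, w) := fun w =>
      (integral_add_left_eq_self (fun u => F (u, w)) w).symm
    simp_rw [e1]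
    rw [integral_integral_swap (f := fun w v => F (w + v, w)) hshift, fourier_eq',
      ← integral_const_mul]
    refine integral_congr_ae (ae_of_all _ fun v => ?_)
    have e2 : ∀ w, F (w + v, w) = (k v * cexp (-ε * ‖v‖ ^ 2) *
        cexp ((-2 * π * (inner ℝ v ξ : ℝ) : ℝ) * I)) *
        ((rexp (-(4 * ε) * ‖w + (2⁻¹ : ℝ) • v‖ ^ 2) : ℝ) : ℂ) := by
      intro w
      have e3 : ‖w + v‖ ^ 2 = ‖w‖ ^ 2 + 2 * inner ℝ w v + ‖v‖ ^ 2 := norm_add_sq_real w v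
      have e4 : ‖w + (2⁻¹ : ℝ) • v‖ ^ 2 = ‖w‖ ^ 2 + inner ℝ w v + ‖v‖ ^ 2 / 4 := by
        rw [norm_add_sq_real, norm_smul, inner_smul_right, mul_pow]
        norm_num
        ring
      simp only [hF, hh, add_sub_cancel_left]
      rw [← Complex.exp_conj]
      simp only [map_add, map_mul, map_neg, map_pow, Complex.conj_ofReal, Complex.conj_I,
        map_ofNat]
      rw [mul_comm _ (k v), Complex.ofReal_exp, mul_assoc (k v), mul_assoc (k v),
        ← Complex.exp_add, ← Complex.exp_add, ← Complex.exp_add]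
      congr 2
      have e3' : (‖w + v‖ : ℂ) ^ 2 = (‖w‖ : ℂ) ^ 2 + 2 * ((inner ℝ w v : ℝ) : ℂ) + (‖v‖ : ℂ) ^ 2 := by
        exact_mod_cast congrArg Complex.ofReal e3
      rw [e3', e4, inner_add_right, real_inner_comm ξ v]
      push_cast
      ring
    simp_rw [e2]
    rw [integral_const_mul, integral_complex_ofReal,
      integral_add_right_eq_self (fun w : V => rexp (-(4 * ε) * ‖w‖ ^ 2))]
    simp only [smul_eq_mul]
    push_cast
    ring
  refine ⟨c⁻¹ * ‖∫ u, h u • φ u‖ ^ 2, by positivity, ?_⟩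
  rw [h2, inner_self_eq_norm_sq_to_K] at h1
  have : (c : ℂ) ≠ 0 := by exact_mod_cast hcpos.ne'
  rw [Complex.ofReal_mul, Complex.ofReal_inv, eq_inv_mul_iff_mul_eq₀ this, Complex.ofReal_pow]
  exact h1.symm

/-- **Bochner's theorem**, for a kernel realized by a continuous stationary map into a Hilbert
space. -/
theorem exists_charFun_eq_of_stationary {φ : V → H} (hφ : Continuous φ) {k : V → ℂ}
    (hk : ∀ v w, inner ℂ (φ v) (φ w) = k (v - w)) :
    ∃ m : Measure V, IsFiniteMeasure m ∧ ∀ v, charFun m v = k v := by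
  have hnorm : ∀ v, ‖φ v‖ = ‖φ 0‖ := by
    intro v
    have h1 := hk v v
    have h2 := hk 0 0
    rw [sub_self, inner_self_eq_norm_sq_to_K] at h1 h2
    rw [← h2] at h1
    have h3 : ‖φ v‖ ^ 2 = ‖φ 0‖ ^ 2 := by exact_mod_cast h1
    exact (pow_left_inj₀ (norm_nonneg _) (norm_nonneg _) two_ne_zero).1 h3
  have hkeq : ∀ v, k v = inner ℂ (φ v) (φ 0) := fun v => by rw [hk, sub_zero]
  have hkc : Continuous k := by
    rw [funext hkeq]; exact hφ.inner continuous_const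
  have hkbd : ∀ v, ‖k v‖ ≤ ‖φ 0‖ * ‖φ 0‖ := fun v => by
    rw [hkeq]
    exact (norm_inner_le_norm _ _).trans (by rw [hnorm])
  have hk0 : k 0 = ((‖φ 0‖ ^ 2 : ℝ) : ℂ) := by
    rw [hkeq, inner_self_eq_norm_sq_to_K]; push_cast; rfl
  rcases eq_or_ne (φ 0) 0 with h0 | h0
  · refine ⟨0, inferInstance, fun v => ?_⟩
    have : ‖k v‖ ≤ 0 := by simpa [h0] using hkbd v
    simp [norm_le_zero_iff.1 this]
  set a : ℝ := ‖φ 0‖ ^ 2 with ha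
  have hapos : 0 < a := by positivity
  have hεpos : ∀ N : ℕ, (0 : ℝ) < ((N : ℝ) + 1)⁻¹ := fun N => by positivity
  have hreg : ∀ N : ℕ, ∃ m : Measure V, IsFiniteMeasure m ∧
      ∀ v, charFun m v = k v * cexp (-(((N : ℝ) + 1)⁻¹ : ℝ) * ‖v‖ ^ 2) := by
    intro N
    choose q hq hfq using fourier_stationary_kernel_nonneg hφ hk (hεpos N)
    refine exists_charFun_eq_of_fourier_nonneg ?_ (by fun_prop) hq hfq
    have hg : Integrable (fun v : V => cexp (-(((N : ℝ) + 1)⁻¹ : ℝ) * ‖v‖ ^ 2)) := by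
      have := GaussianFourier.integrable_cexp_neg_mul_sq_norm_add (V := V)
        (b := (((N : ℝ) + 1)⁻¹ : ℝ)) (by simpa only [Complex.ofReal_re] using hεpos N) 0 0
      simpa using this
    exact hg.bdd_mul hkc.aestronglyMeasurable (ae_of_all _ hkbd)
  choose m hmfin hm using hreg
  have hmass : ∀ N, (m N) Set.univ = ENNReal.ofReal a := by
    intro N
    have h1 := hm N 0
    rw [charFun_zero, hk0] at h1
    simp only [norm_zero, Complex.ofReal_zero, ne_eq, OfNat.ofNat_ne_zero, not_false_eq_true,
      zero_pow, mul_zero, Complex.exp_zero, mul_one] at h1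
    have h2 : (m N).real Set.univ = a := by exact_mod_cast h1
    rw [← h2, ofReal_measureReal]
  -- All regularized measures have the mass `k 0 = ‖φ 0‖²`; normalizing them makes compactness of
  -- tight families of probability measures available.
  let P : ℕ → Measure V := fun N => (ENNReal.ofReal a)⁻¹ • m N
  have hP : ∀ N, IsProbabilityMeasure (P N) := fun N => ⟨by
    simp only [P, Measure.smul_apply, hmass, smul_eq_mul]
    exact ENNReal.inv_mul_cancel (by simpa using hapos) ENNReal.ofReal_ne_top⟩
  have hPchar : ∀ N v, charFun (P N) v =
      a⁻¹ * (k v * cexp (-(((N : ℝ) + 1)⁻¹ : ℝ) * ‖v‖ ^ 2)) := by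
    intro N v
    rw [← hm N v, charFun_apply, charFun_apply]
    simp only [P]
    rw [integral_smul_measure, ENNReal.toReal_inv, ENNReal.toReal_ofReal hapos.le,
      Complex.real_smul]
  have hlim : ∀ v, Tendsto (fun N => charFun (P N) v) atTop (𝓝 (a⁻¹ * k v)) := by
    intro v
    simp_rw [hPchar]
    have hN : Tendsto (fun N : ℕ => ((((N : ℝ) + 1)⁻¹ : ℝ) : ℂ)) atTop (𝓝 ((0 : ℝ) : ℂ)) :=
      (Complex.continuous_ofReal.tendsto _).comp (tendsto_inv_atTop_zero.comp
        (tendsto_atTop_add_const_right _ _ tendsto_natCast_atTop_atTop))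
    have h1 : Tendsto (fun N : ℕ => ((a⁻¹ : ℝ) : ℂ) * (k v * cexp (-(((N : ℝ) + 1)⁻¹ : ℝ) * ‖v‖ ^ 2)))
        atTop (𝓝 (a⁻¹ * (k v * cexp (-((0 : ℝ) : ℂ) * ‖v‖ ^ 2)))) :=
      ((Complex.continuous_exp.tendsto _).comp
        ((hN.neg).mul_const _)).const_mul _ |>.const_mul _
    simpa using h1
  -- As in Lévy's continuity theorem, the characteristic functions converge pointwise to a function
  -- continuous at the origin, so no mass escapes.
  have htight : IsTightMeasureSet (Set.range P) :=
    isTightMeasureSet_of_tendsto_charFun (f := fun v => a⁻¹ * k v)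
      (by fun_prop) hlim
  let Q : ℕ → ProbabilityMeasure V := fun N => ⟨P N, hP N⟩
  have hset : {((μ : ProbabilityMeasure V) : Measure V) | μ ∈ Set.range Q} = Set.range P := by
    ext ν
    exact ⟨fun ⟨_, ⟨N, hN⟩, h⟩ => ⟨N, by rw [← h, ← hN]; rfl⟩, fun ⟨N, h⟩ => ⟨Q N, ⟨N, rfl⟩, h⟩⟩
  have hcompact : IsCompact (closure (Set.range Q)) :=
    isCompact_closure_of_isTightMeasureSet (by rw [hset]; exact htight)
  -- A limit along a free ultrafilter is enough: the characteristic functions already converge along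
  -- the whole sequence, which identifies that of the limit.
  obtain ⟨μ', -, hμ'⟩ := hcompact.ultrafilter_le_nhds ((Filter.hyperfilter ℕ).map Q)
    (le_trans (by simp) (monotone_principal subset_closure))
  have hconv : Tendsto Q (Filter.hyperfilter ℕ) (𝓝 μ') := hμ'
  rw [ProbabilityMeasure.tendsto_iff_forall_integral_rclike_tendsto ℂ] at hconv
  have hchar : ∀ v, charFun (μ' : Measure V) v = a⁻¹ * k v := by
    intro v
    have h1 := hconv (BoundedContinuousFunction.innerProbChar v)
    have h2 := (hlim v).mono_left (Nat.hyperfilter_le_atTop)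
    rw [charFun_eq_integral_innerProbChar]
    refine tendsto_nhds_unique h1 ?_
    simp_rw [charFun_eq_integral_innerProbChar] at h2
    exact h2
  refine ⟨ENNReal.ofReal a • (μ' : Measure V), ?_, fun v => ?_⟩
  · exact ⟨by
      rw [Measure.smul_apply, measure_univ]
      simp⟩
  · have h1 := hchar v
    rw [charFun_apply] at h1 ⊢
    rw [integral_smul_measure, h1, ENNReal.toReal_ofReal hapos.le, Complex.real_smul]
    rw [← mul_assoc, ← Complex.ofReal_mul, mul_inv_cancel₀ hapos.ne', Complex.ofReal_one, one_mul]

end Bochner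

/-! ### Energy estimates for a Bessel-type equation. -/

section BesselEnergy

open Set Real

theorem monotoneOn_Ici_of_hasDerivAt {f f' : ℝ → ℝ} {a : ℝ} (hf : ∀ x, a < x → HasDerivAt f (f' x) x)
    (hc : ContinuousOn f (Ici a)) (h : ∀ x, a < x → 0 ≤ f' x) : MonotoneOn f (Ici a) := by
  refine monotoneOn_of_deriv_nonneg (convex_Ici a) hc ?_ ?_
  · rw [interior_Ici]
    exact fun x hx => (hf x hx).differentiableAt.differentiableWithinAt
  · rw [interior_Ici]
    exact fun x hx => by rw [(hf x hx).deriv]; exact h x hx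

/-- Two-sided bounds for the energy of a solution of the Bessel-type equation
`s a'' + (m + 2) a' + s a = 0`. -/
theorem bessel_energy_bounds (m : ℕ) {a b c : ℝ → ℝ} (ha : ∀ s, HasDerivAt a (b s) s)
    (hb : ∀ s, HasDerivAt b (c s) s) (ode : ∀ s, s * c s + (m + 2) * b s + s * a s = 0)
    (h0 : a 0 ≠ 0) :
    ∃ c₁ c₂ : ℝ, 0 < c₁ ∧ 0 < c₂ ∧ ∀ s, (m + 2 : ℝ) ≤ s →
      c₁ ≤ s ^ (m + 2) * (a s ^ 2 + b s ^ 2) ∧ s ^ (m + 2) * (a s ^ 2 + b s ^ 2) ≤ c₂ := by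
  have hac : Continuous a := continuous_iff_continuousAt.2 fun s => (ha s).continuousAt
  have hbc : Continuous b := continuous_iff_continuousAt.2 fun s => (hb s).continuousAt
  have hsc : ∀ s, s * c s = -((m + 2) * b s) - s * a s := fun s => by linarith [ode s]
  -- The weight `s^(2m+4)` absorbs the damping term, so this energy never decreases. As `a` is
  -- nonzero near `0`, the energy is positive for all `s > 0`.
  have hF : MonotoneOn (fun s => s ^ (2 * m + 4) * (a s ^ 2 + b s ^ 2)) (Ici 0) := by
    refine monotoneOn_Ici_of_hasDerivAt (f' := fun s => 2 * (m + 2) * s ^ (2 * m + 3) * a s ^ 2)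
      (fun s _ => ?_) (by fun_prop) (fun s hs => by positivity)
    have h := ((hasDerivAt_pow (2 * m + 4) s).mul (((ha s).pow 2).add ((hb s).pow 2)))
    refine h.congr_deriv ?_
    simp only [Nat.cast_add, Nat.cast_mul, Nat.cast_ofNat, Pi.add_apply, Pi.pow_apply,
      show 2 * m + 4 - 1 = 2 * m + 3 from rfl]
    rw [show s ^ (2 * m + 4) = s ^ (2 * m + 3) * s from pow_succ _ _]
    linear_combination 2 * b s * s ^ (2 * m + 3) * hsc s
  have hE : ∀ s, 0 < s → 0 < a s ^ 2 + b s ^ 2 := by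
    intro s hs
    obtain ⟨δ, hδ, hδ'⟩ := Metric.eventually_nhds_iff.1 (hac.continuousAt.eventually_ne h0)
    set r := min s (δ / 2) with hr
    have hrpos : 0 < r := lt_min hs (by positivity)
    have har : a r ≠ 0 := hδ' (by
      rw [Real.dist_eq, sub_zero, abs_of_pos hrpos]
      exact (min_le_right _ _).trans_lt (by linarith))
    have h1 := hF (mem_Ici.2 hrpos.le) (mem_Ici.2 hs.le) (min_le_left _ _)
    have h2 : 0 < r ^ (2 * m + 4) * (a r ^ 2 + b r ^ 2) := by positivity
    have h3 : 0 < s ^ (2 * m + 4) * (a s ^ 2 + b s ^ 2) := h2.trans_le h1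
    exact pos_of_mul_pos_right h3 (by positivity)
  -- The natural energy `s^(m+2) (a² + b²)` has derivative `(m+2) s^(m+1) (a² - b²)`, which is too
  -- large to integrate. The cross term cancels it and leaves a derivative of size `O(W / s²)`; for
  -- `s ≥ m + 2` the cross term is at most half of the energy.
  set W : ℝ → ℝ := fun s => s ^ (m + 2) * (a s ^ 2 + b s ^ 2) + (m + 2) * (s ^ (m + 1) * (a s * b s))
    with hW
  have hWd : ∀ s, HasDerivAt W (-((m + 2) * s ^ m * (a s * b s))) s := by
    intro s
    have h := ((hasDerivAt_pow (m + 2) s).mul (((ha s).pow 2).add ((hb s).pow 2))).add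
      ((((hasDerivAt_pow (m + 1) s).mul ((ha s).mul (hb s)))).const_mul ((m : ℝ) + 2))
    refine h.congr_deriv ?_
    simp only [Nat.cast_add, Nat.cast_ofNat, Nat.cast_one, Pi.add_apply, Pi.pow_apply, Pi.mul_apply,
      show m + 2 - 1 = m + 1 from rfl, add_tsub_cancel_right]
    rw [show s ^ (m + 2) = s ^ m * s * s by ring, show s ^ (m + 1) = s ^ m * s by ring]
    linear_combination (2 * b s * s ^ m * s + (m + 2) * s ^ m * a s) * hsc s
  have hab : ∀ s, |a s * b s| ≤ (a s ^ 2 + b s ^ 2) / 2 := fun s => by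
    rw [abs_le]; constructor <;> nlinarith [sq_nonneg (a s + b s), sq_nonneg (a s - b s)]
  have hm2 : (0 : ℝ) < m + 2 := by positivity
  have hWb : ∀ s, (m + 2 : ℝ) ≤ s → |(m + 2) * (s ^ (m + 1) * (a s * b s))| ≤
      s ^ (m + 2) * (a s ^ 2 + b s ^ 2) / 2 := by
    intro s hs
    have hs0 : 0 < s := hm2.trans_le hs
    rw [abs_mul, abs_mul, abs_of_pos hm2, abs_of_pos (pow_pos hs0 _)]
    calc (m + 2 : ℝ) * (s ^ (m + 1) * |a s * b s|)
        ≤ s * (s ^ (m + 1) * ((a s ^ 2 + b s ^ 2) / 2)) := by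
          gcongr
          exact hab s
      _ = _ := by ring
  have hWlow : ∀ s, (m + 2 : ℝ) ≤ s → s ^ (m + 2) * (a s ^ 2 + b s ^ 2) ≤ 2 * W s := fun s hs => by
    have := (abs_le.1 (hWb s hs)).1
    simp only [hW]; linarith
  have hWup : ∀ s, (m + 2 : ℝ) ≤ s → W s ≤ 2 * (s ^ (m + 2) * (a s ^ 2 + b s ^ 2)) := fun s hs => by
    have := (abs_le.1 (hWb s hs)).2
    have hs0 : 0 < s := hm2.trans_le hs
    have : 0 < s ^ (m + 2) * (a s ^ 2 + b s ^ 2) := mul_pos (by positivity) (hE s hs0)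
    simp only [hW]; linarith
  have hWpos : ∀ s, (m + 2 : ℝ) ≤ s → 0 < W s := fun s hs => by
    have hs0 : 0 < s := hm2.trans_le hs
    have : 0 < s ^ (m + 2) * (a s ^ 2 + b s ^ 2) := mul_pos (by positivity) (hE s hs0)
    linarith [hWlow s hs]
  have hW' : ∀ s, (m + 2 : ℝ) ≤ s → |(m + 2) * s ^ m * (a s * b s)| ≤ (m + 2) / s ^ 2 * W s := by
    intro s hs
    have hs0 : 0 < s := hm2.trans_le hs
    rw [abs_mul, abs_of_pos (by positivity : (0 : ℝ) < (m + 2) * s ^ m)]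
    calc (m + 2 : ℝ) * s ^ m * |a s * b s| ≤ (m + 2) * s ^ m * ((a s ^ 2 + b s ^ 2) / 2) := by
          gcongr
          exact hab s
      _ = (m + 2) / s ^ 2 * (s ^ (m + 2) * (a s ^ 2 + b s ^ 2) / 2) := by
          field_simp
          ring
      _ ≤ _ := by
          gcongr
          linarith [hWlow s hs]
  have hexp : ∀ (k : ℝ) s, 0 < s → HasDerivAt (fun s => rexp (k / s)) (rexp (k / s) * (-k / s ^ 2)) s := by
    intro k s hs
    have h1 : HasDerivAt (fun s : ℝ => k / s) (-k / s ^ 2) s := by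
      simpa [div_eq_mul_inv] using (hasDerivAt_inv hs.ne').const_mul k
    exact h1.exp
  have hWc : Continuous W := by rw [hW]; fun_prop
  have hcont : ∀ k : ℝ, ContinuousOn (fun s => W s * rexp (k / s)) (Ici (m + 2 : ℝ)) := by
    intro k
    refine hWc.continuousOn.mul (Real.continuous_exp.comp_continuousOn
      (continuousOn_const.div continuousOn_id fun s hs => ?_))
    exact (hm2.trans_le hs).ne'
  -- Integrating factors for `|W'| ≤ (m+2)/s² · W`: the exponents `∓(m+2)/s` have modulus at most
  -- `1` on this half-line, so `W` stays within constant multiples of its initial value.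
  have hup : MonotoneOn (fun s => W s * rexp (-(m + 2) / s)) (Ici (m + 2 : ℝ)) := by
    refine monotoneOn_Ici_of_hasDerivAt
      (fun s hs => (hWd s).mul (hexp _ s (hm2.trans hs))) (hcont _) (fun s hs => ?_)
    have h1 := (abs_le.1 (hW' s hs.le)).2
    have : 0 ≤ rexp (-(m + 2) / s) * ((m + 2) / s ^ 2 * W s - (m + 2) * s ^ m * (a s * b s)) :=
      mul_nonneg (Real.exp_pos _).le (by linarith)
    linarith [this, show -((m + 2) * s ^ m * (a s * b s)) * rexp (-(m + 2) / s) +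
      W s * (rexp (-(m + 2) / s) * (-(-(m + 2)) / s ^ 2)) = rexp (-(m + 2) / s) *
        ((m + 2) / s ^ 2 * W s - (m + 2) * s ^ m * (a s * b s)) by ring]
  have hdown : MonotoneOn (fun s => -(W s * rexp ((m + 2) / s))) (Ici (m + 2 : ℝ)) := by
    refine monotoneOn_Ici_of_hasDerivAt
      (fun s hs => ((hWd s).mul (hexp _ s (hm2.trans hs))).neg) (hcont _).neg (fun s hs => ?_)
    have h1 := (abs_le.1 (hW' s hs.le)).1
    have : 0 ≤ rexp ((m + 2) / s) * ((m + 2) / s ^ 2 * W s + (m + 2) * s ^ m * (a s * b s)) :=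
      mul_nonneg (Real.exp_pos _).le (by linarith)
    linarith [this, show -(-((m + 2) * s ^ m * (a s * b s)) * rexp ((m + 2) / s) +
      W s * (rexp ((m + 2) / s) * (-(m + 2) / s ^ 2))) = rexp ((m + 2) / s) *
        ((m + 2) / s ^ 2 * W s + (m + 2) * s ^ m * (a s * b s)) by ring]
  have hW0 := hWpos _ le_rfl
  refine ⟨W (m + 2) * rexp (-1) / 2, 2 * (W (m + 2) * rexp 1), by positivity, by positivity,
    fun s hs => ?_⟩
  have hs0 : 0 < s := hm2.trans_le hs
  have h1 := hup (mem_Ici.2 le_rfl) (mem_Ici.2 hs) hs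
  have h2 := hdown (mem_Ici.2 le_rfl) (mem_Ici.2 hs) hs
  simp only [neg_div, div_self hm2.ne', neg_le_neg_iff] at h1 h2
  have h3 : rexp (-((m + 2) / s)) ≤ 1 := Real.exp_le_one_iff.2 (neg_nonpos.2 (by positivity))
  have h4 : 1 ≤ rexp ((m + 2) / s) := Real.one_le_exp (by positivity)
  have h5 := hWpos s hs
  have h6 : W s * rexp (-((m + 2) / s)) ≤ W s := by nlinarith
  have h7 : W s ≤ W s * rexp ((m + 2) / s) := by nlinarith
  constructor
  · linarith [hWup s hs]
  · linarith [hWlow s hs]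

/-- Mean-square lower bound for a solution of the Bessel-type equation. -/
theorem bessel_integral_sq_lower_bound (m : ℕ) {a b c : ℝ → ℝ} (ha : ∀ s, HasDerivAt a (b s) s)
    (hb : ∀ s, HasDerivAt b (c s) s) (ode : ∀ s, s * c s + (m + 2) * b s + s * a s = 0)
    (h0 : a 0 ≠ 0) :
    ∃ C : ℝ, 0 < C ∧ ∀ T : ℝ, 1 ≤ T →
      C * T ^ (m + 1) ≤ ∫ s in (0 : ℝ)..T, s ^ (2 * m + 2) * a s ^ 2 := by
  have hac : Continuous a := continuous_iff_continuousAt.2 fun s => (ha s).continuousAt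
  have hbc : Continuous b := continuous_iff_continuousAt.2 fun s => (hb s).continuousAt
  have hsc : ∀ s, s * c s = -((m + 2) * b s) - s * a s := fun s => by linarith [ode s]
  obtain ⟨c₁, c₂, hc₁, hc₂, hE⟩ := bessel_energy_bounds m ha hb ode h0
  have hm2 : (0 : ℝ) < m + 2 := by positivity
  have hab : ∀ s, |a s * b s| ≤ (a s ^ 2 + b s ^ 2) / 2 := fun s => by
    rw [abs_le]; constructor <;> nlinarith [sq_nonneg (a s + b s), sq_nonneg (a s - b s)]
  set J : ℝ → ℝ := fun T => ∫ s in (0 : ℝ)..T, s ^ (2 * m + 2) * a s ^ 2 with hJ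
  have hcont : Continuous fun s : ℝ => s ^ (2 * m + 2) * a s ^ 2 := by fun_prop
  have hJd : ∀ T, HasDerivAt J (T ^ (2 * m + 2) * a T ^ 2) T := fun T =>
    (hcont.integral_hasStrictDerivAt 0 T).hasDerivAt
  have hJc : Continuous J := continuous_iff_continuousAt.2 fun s => (hJd s).continuousAt
  have hJmono : MonotoneOn J (Ici 0) :=
    monotoneOn_Ici_of_hasDerivAt (fun s _ => hJd s) hJc.continuousOn (fun s hs => by positivity)
  have hJ1 : 0 < J 1 := by
    obtain ⟨δ, hδ, hδ'⟩ := Metric.eventually_nhds_iff.1 (hac.continuousAt.eventually_ne h0)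
    set r := min 1 (δ / 2) with hr
    have hrpos : 0 < r := lt_min one_pos (by positivity)
    have har : a r ≠ 0 := hδ' (by
      rw [Real.dist_eq, sub_zero, abs_of_pos hrpos]
      exact (min_le_right _ _).trans_lt (by linarith))
    exact intervalIntegral.integral_pos one_pos hcont.continuousOn
      (fun x hx => by have := hx.1; positivity)
      ⟨r, ⟨hrpos.le, min_le_left _ _⟩, by positivity⟩
  set c₃ : ℝ := c₁ / (2 * (m + 1)) with hc₃
  have hc₃pos : 0 < c₃ := by positivity
  -- Equipartition: the derivative of `s^(2m+2) a b` contributes `s^(2m+2) (b² - a²)`, so adding it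
  -- to `2J` replaces `2a²` by the full energy `a² + b²`, up to a cross term. The energy bound gives
  -- `c₁ s^m`; half of it pays for the cross term and the other half for `c₃ s^(m+1)`.
  set G : ℝ → ℝ := fun s => 2 * J s + s ^ (2 * m + 2) * (a s * b s) - c₃ * s ^ (m + 1) with hG
  have hGd : ∀ s, HasDerivAt G (s ^ (2 * m + 2) * (a s ^ 2 + b s ^ 2) +
      m * s ^ (2 * m + 1) * (a s * b s) - c₁ / 2 * s ^ m) s := by
    intro s
    have h := (((hJd s).const_mul 2).add
      ((hasDerivAt_pow (2 * m + 2) s).mul ((ha s).mul (hb s)))).sub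
      ((hasDerivAt_pow (m + 1) s).const_mul c₃)
    refine h.congr_deriv ?_
    simp only [Nat.cast_add, Nat.cast_mul, Nat.cast_ofNat, Nat.cast_one, Pi.mul_apply,
      show 2 * m + 2 - 1 = 2 * m + 1 from rfl, add_tsub_cancel_right]
    have e : c₃ * ((m + 1) * s ^ m) = c₁ / 2 * s ^ m := by rw [hc₃]; field_simp
    rw [e, show s ^ (2 * m + 2) = s ^ (2 * m + 1) * s from pow_succ _ _]
    linear_combination s ^ (2 * m + 1) * a s * hsc s
  have hGc : Continuous G := continuous_iff_continuousAt.2 fun s => (hGd s).continuousAt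
  have hGmono : MonotoneOn G (Ici (m + 2 : ℝ)) := by
    refine monotoneOn_Ici_of_hasDerivAt (fun s _ => hGd s) hGc.continuousOn (fun s hs => ?_)
    have hs0 : 0 < s := hm2.trans hs
    have h1 : |m * s ^ (2 * m + 1) * (a s * b s)| ≤ s ^ (2 * m + 2) * (a s ^ 2 + b s ^ 2) / 2 := by
      rw [abs_mul, abs_of_nonneg (by positivity : (0 : ℝ) ≤ m * s ^ (2 * m + 1))]
      calc (m : ℝ) * s ^ (2 * m + 1) * |a s * b s|
          ≤ s * s ^ (2 * m + 1) * ((a s ^ 2 + b s ^ 2) / 2) := by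
            gcongr
            · linarith
            · exact hab s
        _ = _ := by ring
    have h2 := (hE s hs.le).1
    have h3 : c₁ * s ^ m ≤ s ^ (2 * m + 2) * (a s ^ 2 + b s ^ 2) := by
      calc c₁ * s ^ m ≤ s ^ (m + 2) * (a s ^ 2 + b s ^ 2) * s ^ m := by gcongr
        _ = _ := by ring
    have h4 := (abs_le.1 h1).1
    linarith
  set K := |G (m + 2)| with hK
  set T₀ : ℝ := max (m + 2) (2 * (c₂ + K) / c₃) with hT₀
  have hT₀1 : (1 : ℝ) ≤ T₀ := le_max_of_le_left (by linarith [(Nat.cast_nonneg m : (0 : ℝ) ≤ m)])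
  have hKnn : 0 ≤ K := abs_nonneg _
  -- Beyond `T₀` the boundary term and `G (m + 2)` use up at most half of `c₃ T^(m+1)`, leaving
  -- `c₃/4` for `J`. On `[1, T₀]` monotonicity of `J` suffices.
  refine ⟨min (c₃ / 4) (J 1 / T₀ ^ (m + 1)), lt_min (by positivity) (by positivity), fun T hT => ?_⟩
  have hT0 : 0 < T := by linarith
  change _ ≤ J T
  rcases le_total T T₀ with hle | hge
  · calc _ ≤ J 1 / T₀ ^ (m + 1) * T ^ (m + 1) := by gcongr; exact min_le_right _ _
      _ ≤ J 1 / T₀ ^ (m + 1) * T₀ ^ (m + 1) := by gcongr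
      _ = J 1 := by field_simp
      _ ≤ J T := hJmono (mem_Ici.2 zero_le_one) (mem_Ici.2 hT0.le) hT
  · have hsm : (m + 2 : ℝ) ≤ T := (le_max_left _ _).trans hge
    have h1 := hGmono (mem_Ici.2 le_rfl) (mem_Ici.2 hsm) hsm
    have h2 : -K ≤ G (m + 2) := neg_abs_le _
    have h3 : |T ^ (2 * m + 2) * (a T * b T)| ≤ c₂ * T ^ m := by
      rw [abs_mul, abs_of_pos (by positivity : 0 < T ^ (2 * m + 2))]
      calc T ^ (2 * m + 2) * |a T * b T| ≤ T ^ (2 * m + 2) * ((a T ^ 2 + b T ^ 2) / 2) := by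
            gcongr
            exact hab T
        _ ≤ T ^ (2 * m + 2) * (a T ^ 2 + b T ^ 2) := by
            gcongr
            linarith [sq_nonneg (a T), sq_nonneg (b T)]
        _ = (T ^ (m + 2) * (a T ^ 2 + b T ^ 2)) * T ^ m := by ring
        _ ≤ _ := by gcongr; exact (hE T hsm).2
    have h4 := (abs_le.1 h3).2
    have h5 : K ≤ K * T ^ m := le_mul_of_one_le_right hKnn (one_le_pow₀ hT)
    have h6 : 2 * (c₂ + K) ≤ c₃ * T := by
      have := (div_le_iff₀ hc₃pos).1 ((le_max_right (m + 2 : ℝ) _).trans hge)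
      linarith
    have h7 : 2 * (c₂ + K) * T ^ m ≤ c₃ * T * T ^ m := by gcongr
    have h8 : c₃ * T * T ^ m = c₃ * T ^ (m + 1) := by ring
    have h9 : G T = 2 * J T + T ^ (2 * m + 2) * (a T * b T) - c₃ * T ^ (m + 1) := rfl
    calc _ ≤ c₃ / 4 * T ^ (m + 1) := by gcongr; exact min_le_left _ _
      _ ≤ J T := by linarith

end BesselEnergy

/-! ### The Fourier transform of a ball as a one-variable cosine transform. -/

section BallTransform

open Set Real

/-- The cosine transform of `(1 - t²)^{m/2}` on `[-1, 1]`, a multiple of a Bessel function. -/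
noncomputable def sphericalCos (m : ℕ) (s : ℝ) : ℝ :=
  ∫ t in (-1 : ℝ)..1, cos (s * t) * (1 - t ^ 2) ^ ((m : ℝ) / 2)

theorem hasDerivAt_integral_cos_mul {g : ℝ → ℝ} (hg : Continuous g) (s : ℝ) :
    HasDerivAt (fun s => ∫ t in (-1 : ℝ)..1, cos (s * t) * g t)
      (∫ t in (-1 : ℝ)..1, -(sin (s * t) * (t * g t))) s := by
  refine (intervalIntegral.hasDerivAt_integral_of_dominated_loc_of_deriv_le
    (F := fun s t => cos (s * t) * g t) (F' := fun s t => -(sin (s * t) * (t * g t)))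
    (bound := fun t => |t * g t|) Filter.univ_mem ?_ ?_ ?_ ?_ ?_ ?_).2
  · exact .of_forall fun x => Continuous.aestronglyMeasurable (by fun_prop)
  · exact Continuous.intervalIntegrable (by fun_prop) _ _
  · exact Continuous.aestronglyMeasurable (by fun_prop)
  · refine .of_forall fun t _ x _ => ?_
    rw [norm_neg, norm_mul, Real.norm_eq_abs, Real.norm_eq_abs]
    exact mul_le_of_le_one_left (abs_nonneg _) (abs_sin_le_one _)
  · exact Continuous.intervalIntegrable (by fun_prop) _ _
  · refine .of_forall fun t _ x _ => ?_
    have h : HasDerivAt (fun x : ℝ => x * t) t x := by simpa using (hasDerivAt_id x).mul_const t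
    exact ((h.cos).mul_const (g t)).congr_deriv (by ring)

theorem hasDerivAt_integral_sin_mul {g : ℝ → ℝ} (hg : Continuous g) (s : ℝ) :
    HasDerivAt (fun s => ∫ t in (-1 : ℝ)..1, -(sin (s * t) * g t))
      (∫ t in (-1 : ℝ)..1, -(cos (s * t) * (t * g t))) s := by
  refine (intervalIntegral.hasDerivAt_integral_of_dominated_loc_of_deriv_le
    (F := fun s t => -(sin (s * t) * g t)) (F' := fun s t => -(cos (s * t) * (t * g t)))
    (bound := fun t => |t * g t|) Filter.univ_mem ?_ ?_ ?_ ?_ ?_ ?_).2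
  · exact .of_forall fun x => Continuous.aestronglyMeasurable (by fun_prop)
  · exact Continuous.intervalIntegrable (by fun_prop) _ _
  · exact Continuous.aestronglyMeasurable (by fun_prop)
  · refine .of_forall fun t _ x _ => ?_
    rw [norm_neg, norm_mul, Real.norm_eq_abs, Real.norm_eq_abs]
    exact mul_le_of_le_one_left (abs_nonneg _) (abs_cos_le_one _)
  · exact Continuous.intervalIntegrable (by fun_prop) _ _
  · refine .of_forall fun t _ x _ => ?_
    have h : HasDerivAt (fun x : ℝ => x * t) t x := by simpa using (hasDerivAt_id x).mul_const t
    exact ((h.sin).mul_const (g t)).neg.congr_deriv (by ring)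

theorem continuous_one_sub_sq_rpow (m : ℕ) :
    Continuous fun t : ℝ => (1 - t ^ 2) ^ ((m : ℝ) / 2) :=
  Continuous.rpow_const (by fun_prop) fun _ => Or.inr (by positivity)

theorem continuous_sphericalCos (m : ℕ) : Continuous (sphericalCos m) :=
  continuous_iff_continuousAt.2 fun s =>
    (hasDerivAt_integral_cos_mul (continuous_one_sub_sq_rpow m) s).continuousAt

theorem sphericalCos_zero_pos (m : ℕ) : 0 < sphericalCos m 0 := by
  unfold sphericalCos
  refine intervalIntegral.integral_pos (by norm_num)
    (Continuous.continuousOn (by have := continuous_one_sub_sq_rpow m; fun_prop)) ?_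
    ⟨0, by norm_num, by simp⟩
  intro t ht
  have : 0 ≤ 1 - t ^ 2 := by nlinarith [ht.1, ht.2]
  simpa using Real.rpow_nonneg this _

/-- Mean-square growth of `s ^ (m + 1) * sphericalCos m s`. -/
theorem sphericalCos_integral_sq_lower_bound (m : ℕ) :
    ∃ C : ℝ, 0 < C ∧ ∀ T : ℝ, 1 ≤ T →
      C * T ^ (m + 1) ≤ ∫ s in (0 : ℝ)..T, s ^ (2 * m + 2) * sphericalCos m s ^ 2 := by
  set w : ℝ → ℝ := fun t => (1 - t ^ 2) ^ ((m : ℝ) / 2) with hw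
  have hwc : Continuous w := continuous_one_sub_sq_rpow m
  refine bessel_integral_sq_lower_bound m (fun s => hasDerivAt_integral_cos_mul hwc s)
    (fun s => hasDerivAt_integral_sin_mul (g := fun t => t * w t) (by fun_prop) s) (fun s => ?_)
    (sphericalCos_zero_pos m).ne'
  -- The differential equation is this integration by parts: the integrand is the derivative of
  -- `sin(st) (1 - t²)^(m/2+1)`, which vanishes at both endpoints.
  have hibp : ∫ t in (-1 : ℝ)..1, (s * cos (s * t) * ((1 - t ^ 2) * w t)
      - (m + 2) * (t * sin (s * t) * w t)) = 0 := by
    have hd : ∀ t ∈ uIcc (-1 : ℝ) 1, HasDerivAt (fun t => sin (s * t) * (1 - t ^ 2) ^ ((m : ℝ) / 2 + 1))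
        (s * cos (s * t) * ((1 - t ^ 2) * w t) - (m + 2) * (t * sin (s * t) * w t)) t := by
      intro t ht
      rw [uIcc_of_le (by norm_num)] at ht
      have hnn : 0 ≤ 1 - t ^ 2 := by nlinarith [ht.1, ht.2]
      have h1 : HasDerivAt (fun t : ℝ => s * t) s t := by simpa using (hasDerivAt_id t).const_mul s
      have h2 : HasDerivAt (fun t : ℝ => 1 - t ^ 2) (-(2 * t)) t := by
        simpa using (hasDerivAt_pow 2 t).const_sub 1
      have h3 := h2.rpow_const (p := (m : ℝ) / 2 + 1) (Or.inr (by
        have : (0 : ℝ) ≤ m := Nat.cast_nonneg m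
        linarith))
      refine (h1.sin.mul h3).congr_deriv ?_
      rw [add_sub_cancel_right, Real.rpow_add_one' hnn (by positivity)]
      simp only [hw]
      ring
    rw [intervalIntegral.integral_eq_sub_of_hasDerivAt hd
      (Continuous.intervalIntegrable (by fun_prop) _ _)]
    have : (m : ℝ) / 2 + 1 ≠ 0 := by positivity
    simp [Real.zero_rpow this]
  rw [show sphericalCos m s = ∫ t in (-1 : ℝ)..1, cos (s * t) * w t from rfl,
    ← intervalIntegral.integral_const_mul, ← intervalIntegral.integral_const_mul,
    ← intervalIntegral.integral_const_mul, ← intervalIntegral.integral_add,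
    ← intervalIntegral.integral_add, ← hibp]
  · refine intervalIntegral.integral_congr fun t _ => ?_
    ring
  all_goals exact Continuous.intervalIntegrable (by fun_prop) _ _

open RandomMeasure in
/-- Slicing the unit ball by hyperplanes orthogonal to the first coordinate axis. -/
theorem setIntegral_unitBall_comp_coord (m : ℕ) {g : ℝ → ℝ} (hg : Continuous g) :
    ∫ x in Metric.ball (0 : Euc (m + 1)) 1, g (x 0) =
      volume.real (Metric.ball (0 : Euc m) 1) *
        ∫ t in (-1 : ℝ)..1, g t * (1 - t ^ 2) ^ ((m : ℝ) / 2) := by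
  let e : Euc (m + 1) → ℝ × Euc m := fun x => (x 0, WithLp.toLp 2 fun i => x i.succ)
  let e' : Euc (m + 1) ≃ᵐ ℝ × Euc m :=
    ((MeasurableEquiv.toLp 2 (Fin (m + 1) → ℝ)).symm.trans
      (MeasurableEquiv.piFinSuccAbove (fun _ => ℝ) 0)).trans
      ((MeasurableEquiv.refl ℝ).prodCongr (MeasurableEquiv.toLp 2 (Fin m → ℝ)))
  have hee : (e' : Euc (m + 1) → ℝ × Euc m) = e := rfl
  have hmp : MeasurePreserving e volume (volume.prod volume) := by
    rw [← hee]
    exact ((MeasurePreserving.id volume).prod (PiLp.volume_preserving_toLp (Fin m))).comp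
      ((volume_preserving_piFinSuccAbove (fun _ : Fin (m + 1) => ℝ) 0).comp
        (PiLp.volume_preserving_ofLp (Fin (m + 1))))
  have hemb : MeasurableEmbedding e := hee ▸ e'.measurableEmbedding
  set S : Set (ℝ × Euc m) := {p | p.1 ^ 2 + ‖p.2‖ ^ 2 < 1} with hS
  have hSm : MeasurableSet S := (isOpen_lt (by fun_prop) continuous_const).measurableSet
  have hpre : Metric.ball (0 : Euc (m + 1)) 1 = e ⁻¹' S := by
    ext x
    have h1 : ‖x‖ ^ 2 = (e x).1 ^ 2 + ‖(e x).2‖ ^ 2 := by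
      rw [EuclideanSpace.real_norm_sq_eq, EuclideanSpace.real_norm_sq_eq, Fin.sum_univ_succ]
    rw [mem_ball_zero_iff, mem_preimage, hS, mem_ofPred_eq, ← h1]
    exact (sq_lt_one_iff₀ (norm_nonneg _)).symm
  have hvol : (volume.prod volume) S < ⊤ := by
    rw [← hmp.measure_preimage hSm.nullMeasurableSet, ← hpre]
    exact measure_ball_lt_top
  have hSt : ∀ p ∈ S, p.1 ∈ Icc (-1 : ℝ) 1 := by
    intro p hp
    have h1 : p.1 ^ 2 + ‖p.2‖ ^ 2 < 1 := hp
    exact abs_le.1 (abs_le_one_iff_mul_self_le_one.2 (by nlinarith [sq_nonneg ‖p.2‖]))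
  have hint : IntegrableOn (fun p : ℝ × Euc m => g p.1) S (volume.prod volume) := by
    obtain ⟨M, hM⟩ := isCompact_Icc.exists_bound_of_continuousOn (hg.continuousOn (s := Icc (-1 : ℝ) 1))
    refine Measure.integrableOn_of_bounded (M := M) hvol.ne
      (Continuous.aestronglyMeasurable (by fun_prop)) ?_
    exact (ae_restrict_iff' hSm).2 (.of_forall fun p hp => hM _ (hSt p hp))
  have h1 : ∫ x in Metric.ball (0 : Euc (m + 1)) 1, g (x 0) =
      ∫ p in S, g p.1 ∂(volume.prod volume) := by
    rw [hpre]
    exact hmp.setIntegral_preimage_emb hemb (fun p => g p.1) S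
  -- Passing to the open interval keeps the slice radius `√(1 - t²)` strictly positive, so that its
  -- volume scales as `(1 - t²)^(m/2)`.
  rw [h1, ← integral_indicator hSm, integral_prod _ (hint.integrable_indicator hSm),
    intervalIntegral.integral_of_le (by norm_num), integral_Ioc_eq_integral_Ioo,
    ← integral_const_mul, ← integral_indicator measurableSet_Ioo]
  refine integral_congr_ae (.of_forall fun t => ?_)
  by_cases ht : t ∈ Ioo (-1 : ℝ) 1
  · have hpos : 0 < 1 - t ^ 2 := by nlinarith [ht.1, ht.2]
    have hslice : ∀ y : Euc m, S.indicator (fun p : ℝ × Euc m => g p.1) (t, y) =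
        (Metric.ball (0 : Euc m) (√(1 - t ^ 2))).indicator (fun _ => g t) y := by
      intro y
      have : (t, y) ∈ S ↔ y ∈ Metric.ball (0 : Euc m) (√(1 - t ^ 2)) := by
        rw [mem_ball_zero_iff, Real.lt_sqrt (norm_nonneg _), hS, mem_ofPred_eq]
        constructor <;> intro h <;> linarith
      by_cases hy : (t, y) ∈ S
      · rw [indicator_of_mem hy, indicator_of_mem (this.1 hy)]
      · rw [indicator_of_notMem hy, indicator_of_notMem (fun h => hy (this.2 h))]
    simp only [hslice, indicator_of_mem ht]
    rw [integral_indicator Metric.isOpen_ball.measurableSet, setIntegral_const, smul_eq_mul,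
      Measure.real, Measure.addHaar_ball_of_pos _ _ (Real.sqrt_pos.2 hpos), ENNReal.toReal_mul,
      ENNReal.toReal_ofReal (by positivity), finrank_euclideanSpace_fin, Real.sqrt_eq_rpow,
      ← Real.rpow_natCast, ← Real.rpow_mul hpos.le, one_div_mul_eq_div, Measure.real]
    ring
  · rw [indicator_of_notMem ht]
    refine (integral_congr_ae (.of_forall fun y => ?_)).trans (integral_zero _ _)
    refine indicator_of_notMem (fun h => ht ?_) _
    have h1 : t ^ 2 + ‖y‖ ^ 2 < 1 := h
    exact abs_lt.1 ((sq_lt_one_iff_abs_lt_one t).1 (by nlinarith [sq_nonneg ‖y‖]))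

-- The ball and Lebesgue measure are rotation invariant, so a reflection carrying `ξ` to `‖ξ‖` times
-- the first basis vector reduces this to the slicing formula.
open RandomMeasure in
theorem setIntegral_unitBall_cos_inner (m : ℕ) (ξ : Euc (m + 1)) :
    ∫ x in Metric.ball (0 : Euc (m + 1)) 1, cos (inner ℝ x ξ) =
      volume.real (Metric.ball (0 : Euc m) 1) * sphericalCos m ‖ξ‖ := by
  obtain ⟨U, hU⟩ : ∃ U : Euc (m + 1) ≃ₗᵢ[ℝ] Euc (m + 1),
      U ξ = EuclideanSpace.single 0 ‖ξ‖ :=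
    ⟨_, Submodule.reflection_sub (v := ξ) (w := EuclideanSpace.single 0 ‖ξ‖) (by simp)⟩
  have h1 := setIntegral_unitBall_comp_coord m (g := fun t => cos (‖ξ‖ * t)) (by fun_prop)
  unfold sphericalCos
  rw [← h1, ← U.measurePreserving.setIntegral_preimage_emb U.toHomeomorph.measurableEmbedding
    (fun x => cos (‖ξ‖ * x 0))]
  have hb : U ⁻¹' Metric.ball 0 1 = Metric.ball 0 1 := by ext x; simp
  rw [hb]
  refine integral_congr_ae (.of_forall fun x => ?_)
  simp only []
  rw [← U.inner_map_map, hU, EuclideanSpace.inner_single_right]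
  simp [mul_comm]

open RandomMeasure in
/-- The Fourier transform of the indicator function of a ball. -/
theorem re_fourierTransform_indicator_ball (m : ℕ) {r : ℝ} (hr : 0 < r) (ξ : Euc (m + 1)) :
    (fourierTransform ((Metric.ball (0 : Euc (m + 1)) r).indicator 1) ξ).re =
      volume.real (Metric.ball (0 : Euc m) 1) * (r ^ (m + 1) * sphericalCos m (r * ‖ξ‖)) := by
  have h0 : ∀ x, (Metric.ball (0 : Euc (m + 1)) r).indicator (1 : Euc (m + 1) → ℂ) x *
      Complex.exp (-(Complex.I * ((inner ℝ x ξ : ℝ) : ℂ))) =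
      (Metric.ball (0 : Euc (m + 1)) r).indicator
        (fun x => Complex.exp (-(Complex.I * ((inner ℝ x ξ : ℝ) : ℂ)))) x := by
    intro x
    by_cases hx : x ∈ Metric.ball (0 : Euc (m + 1)) r <;> simp [hx]
  have hre : ∀ x : Euc (m + 1), (Complex.exp (-(Complex.I * ((inner ℝ x ξ : ℝ) : ℂ)))).re =
      cos (inner ℝ x ξ) := by
    intro x
    rw [Complex.exp_re]
    simp
  unfold fourierTransform
  simp_rw [h0]
  rw [integral_indicator Metric.isOpen_ball.measurableSet]
  have hint : IntegrableOn (fun x : Euc (m + 1) =>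
      Complex.exp (-(Complex.I * ((inner ℝ x ξ : ℝ) : ℂ)))) (Metric.ball 0 r) := by
    refine Measure.integrableOn_of_bounded (M := 1) measure_ball_lt_top.ne
      (Continuous.aestronglyMeasurable (by fun_prop)) (.of_forall fun x => ?_)
    rw [Complex.norm_exp]
    simp
  have h2 : (∫ x in Metric.ball (0 : Euc (m + 1)) r,
      Complex.exp (-(Complex.I * ((inner ℝ x ξ : ℝ) : ℂ)))).re =
      ∫ x in Metric.ball (0 : Euc (m + 1)) r, cos (inner ℝ x ξ) := by
    rw [← RCLike.re_eq_complex_re, ← integral_re hint]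
    exact integral_congr_ae (.of_forall hre)
  rw [h2]
  have h3 := Measure.setIntegral_comp_smul (volume : Measure (Euc (m + 1)))
    (fun x => cos (inner ℝ x ξ)) (Metric.ball 0 1) hr.ne'
  rw [smul_unitBall_of_pos hr, finrank_euclideanSpace_fin] at h3
  have h4 := setIntegral_unitBall_cos_inner m (r • ξ)
  simp only [inner_smul_left, inner_smul_right, norm_smul, Real.norm_of_nonneg hr.le,
    RCLike.conj_to_real] at h3 h4
  rw [h4, smul_eq_mul, abs_of_pos (by positivity), eq_inv_mul_iff_mul_eq₀ (by positivity)] at h3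
  rw [← h3]
  ring

end BallTransform

/-! ### Linear statistics: measurability, square-integrability, invariance. -/

noncomputable section

namespace RandomMeasure

open Filter Topology Set

variable {n : ℕ}

instance (p : LocFinMeasure n) : IsLocallyFiniteMeasure p.1 := p.2

theorem measure_lt_top_of_isBounded (p : LocFinMeasure n) {B : Set (Euc n)}
    (hB : Bornology.IsBounded B) : p.1 B < ⊤ := hB.measure_lt_top

theorem measurable_apply {B : Set (Euc n)} (hB : MeasurableSet B) :
    Measurable fun p : LocFinMeasure n => p.1 B :=
  (Measure.measurable_coe hB).comp measurable_subtype_coe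

theorem measurable_translateMeasure (v : Euc n) : Measurable (translateMeasure v) := by
  refine Measurable.subtype_mk (Measure.measurable_of_measurable_coe _ fun s hs => ?_)
  have hm : Measurable fun x : Euc n => v + x := by fun_prop
  simp_rw [Measure.map_apply hm hs]
  exact measurable_apply (hm hs)

/-- The tautological kernel `p ↦ p`. -/
def tautKernel (n : ℕ) : Kernel (LocFinMeasure n) (Euc n) := ⟨Subtype.val, measurable_subtype_coe⟩

/-- The mass `p(s)` is finite for each `p` but not bounded in `p`. Dividing by `1 + p(s)` gives a
finite kernel, and the finite density `1 + p(s)` restores the original. S-finiteness is what makes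
`p ↦ ∫ f dp` measurable. -/
theorem isSFiniteKernel_restrict_tautKernel {s : Set (Euc n)} (hs : MeasurableSet s)
    (hb : Bornology.IsBounded s) : IsSFiniteKernel ((tautKernel n).restrict hs) := by
  have hm := measurable_apply hs
  let η : Kernel (LocFinMeasure n) (Euc n) := ⟨fun p => (1 + p.1 s)⁻¹ • p.1.restrict s, by
    refine Measure.measurable_of_measurable_coe _ fun t ht => ?_
    simp only [Measure.smul_apply, Measure.restrict_apply ht, smul_eq_mul]
    exact (measurable_const.add hm).inv.mul (measurable_apply (ht.inter hs))⟩
  have hη : IsFiniteKernel η := ⟨1, ENNReal.one_lt_top, fun p => by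
    change (1 + p.1 s)⁻¹ * p.1.restrict s univ ≤ 1
    rw [Measure.restrict_apply_univ]
    refine le_trans (mul_le_mul_right le_add_self _) (ENNReal.inv_mul_le_one _)⟩
  have hmeas : Measurable (Function.uncurry fun (p : LocFinMeasure n) (_ : Euc n) => 1 + p.1 s) :=
    (measurable_const.add hm).comp measurable_fst
  have heq : (tautKernel n).restrict hs = η.withDensity fun p _ => 1 + p.1 s := by
    refine Kernel.ext fun p => ?_
    rw [Kernel.withDensity_apply _ hmeas, withDensity_const, Kernel.restrict_apply]
    change p.1.restrict s = (1 + p.1 s) • (1 + p.1 s)⁻¹ • p.1.restrict s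
    rw [smul_smul, ENNReal.mul_inv_cancel (by simp)
      (ENNReal.add_ne_top.2 ⟨ENNReal.one_ne_top, (measure_lt_top_of_isBounded p hb).ne⟩), one_smul]
  rw [heq]
  exact Kernel.IsSFiniteKernel.withDensity _ fun p _ =>
    ENNReal.add_ne_top.2 ⟨ENNReal.one_ne_top, (measure_lt_top_of_isBounded p hb).ne⟩

instance : IsSFiniteKernel (tautKernel n) := by
  let B : ℕ → Set (Euc n) := fun k => Metric.ball 0 k
  have hBm : ∀ k, MeasurableSet (disjointed B k) :=
    fun k => MeasurableSet.disjointed (fun i => Metric.isOpen_ball.measurableSet) k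
  have hBb : ∀ k, Bornology.IsBounded (disjointed B k) :=
    fun k => Metric.isBounded_ball.subset (disjointed_subset B k)
  have heq : tautKernel n = Kernel.sum fun k => (tautKernel n).restrict (hBm k) := by
    refine Kernel.ext fun p => ?_
    rw [Kernel.sum_apply]
    simp_rw [Kernel.restrict_apply]
    rw [← Measure.restrict_iUnion (disjoint_disjointed B) hBm, iUnion_disjointed, Metric.iUnion_ball_nat,
      Measure.restrict_univ]
  rw [heq]
  have := fun k => isSFiniteKernel_restrict_tautKernel (hBm k) (hBb k)
  infer_instance

/-- The translate `x ↦ f (x - v)`. -/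
def shift (v : Euc n) (f : Euc n → ℂ) : Euc n → ℂ := fun x => f (x - v)

namespace IsBoundedlySupported

variable {f g : Euc n → ℂ}

theorem exists_bound (hf : IsBoundedlySupported f) : ∃ M : ℝ, 0 ≤ M ∧ ∀ x, ‖f x‖ ≤ M :=
  let ⟨M, hM⟩ := hf.bounded
  ⟨M, (norm_nonneg _).trans (hM 0), hM⟩

theorem exists_radius (hf : IsBoundedlySupported f) :
    ∃ R : ℝ, 0 < R ∧ ∀ x, f x ≠ 0 → ‖x‖ ≤ R := by
  obtain ⟨R, hR, h⟩ := hf.support.exists_pos_norm_le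
  exact ⟨R, hR, fun x hx => h x hx⟩

theorem of_radius (hm : Measurable f) {M : ℝ} (hM : ∀ x, ‖f x‖ ≤ M) {R : ℝ}
    (hR : ∀ x, f x ≠ 0 → ‖x‖ ≤ R) : IsBoundedlySupported f :=
  ⟨hm, ⟨M, hM⟩, (Metric.isBounded_closedBall (x := (0 : Euc n)) (r := R)).subset
    fun x hx => by simpa using hR x hx⟩

theorem shift (hf : IsBoundedlySupported f) (v : Euc n) : IsBoundedlySupported (shift v f) := by
  obtain ⟨M, -, hM⟩ := hf.exists_bound
  obtain ⟨R, -, hR⟩ := hf.exists_radius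
  refine of_radius (hf.measurable.comp (measurable_id.sub_const v)) (fun x => hM (x - v))
    (R := R + ‖v‖) fun x hx => ?_
  have := hR _ hx
  have h2 := norm_add_le (x - v) v
  rw [sub_add_cancel] at h2
  linarith

theorem add (hf : IsBoundedlySupported f) (hg : IsBoundedlySupported g) :
    IsBoundedlySupported (f + g) := by
  obtain ⟨M, hM⟩ := hf.bounded
  obtain ⟨N, hN⟩ := hg.bounded
  exact ⟨hf.measurable.add hg.measurable, ⟨M + N, fun x => norm_add_le_of_le (hM x) (hN x)⟩,
    (hf.support.union hg.support).subset (Function.support_add f g)⟩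

theorem const_smul (hf : IsBoundedlySupported f) (c : ℂ) : IsBoundedlySupported (c • f) := by
  obtain ⟨M, hM⟩ := hf.bounded
  refine ⟨hf.measurable.const_smul c, ⟨‖c‖ * M, fun x => ?_⟩,
    hf.support.subset (Function.support_const_smul_subset c f)⟩
  rw [Pi.smul_apply, norm_smul]
  exact mul_le_mul_of_nonneg_left (hM x) (norm_nonneg _)

theorem sub (hf : IsBoundedlySupported f) (hg : IsBoundedlySupported g) :
    IsBoundedlySupported (f - g) := by
  have := hf.add (hg.const_smul (-1))
  rwa [neg_one_smul, ← sub_eq_add_neg] at this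

theorem integrable (hf : IsBoundedlySupported f) (ν : Measure (Euc n)) [IsLocallyFiniteMeasure ν] :
    Integrable f ν := by
  obtain ⟨M, hM⟩ := hf.bounded
  obtain ⟨R, -, hR⟩ := hf.exists_radius
  have h1 : IntegrableOn f (Metric.closedBall 0 R) ν :=
    Measure.integrableOn_of_bounded Metric.isBounded_closedBall.measure_lt_top.ne
      hf.measurable.aestronglyMeasurable (.of_forall hM)
  rwa [integrableOn_iff_integrable_of_support_subset fun x hx => by simpa using hR x hx] at h1

theorem indicator_ball (r : ℝ) : IsBoundedlySupported ((Metric.ball (0 : Euc n) r).indicator 1) := by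
  refine ⟨measurable_one.indicator Metric.isOpen_ball.measurableSet, ⟨1, fun x => ?_⟩,
    Metric.isBounded_ball.subset support_indicator_subset⟩
  exact (norm_indicator_le_norm_self _ _).trans (by simp)

end IsBoundedlySupported

variable {f g : Euc n → ℂ}

theorem stronglyMeasurable_linearStatistic (hf : Measurable f) :
    StronglyMeasurable (linearStatistic f) :=
  StronglyMeasurable.integral_kernel (κ := tautKernel n) hf.stronglyMeasurable

theorem stronglyMeasurable_linearStatistic_shift (hf : Measurable f) :
    StronglyMeasurable fun z : Euc n × LocFinMeasure n => linearStatistic (shift z.1 f) z.2 := by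
  refine StronglyMeasurable.integral_kernel_prod_right'
    (κ := Kernel.prodMkLeft (Euc n) (tautKernel n))
    (f := fun q : (Euc n × LocFinMeasure n) × Euc n => f (q.2 - q.1.1)) ?_
  exact (hf.comp (measurable_snd.sub measurable_fst.fst)).stronglyMeasurable

theorem linearStatistic_shift (v : Euc n) (f : Euc n → ℂ) (p : LocFinMeasure n) :
    linearStatistic (shift v f) p = linearStatistic f (translateMeasure (-v) p) := by
  unfold linearStatistic translateMeasure shift
  change _ = ∫ x, f x ∂(p.1.map (MeasurableEquiv.addLeft (-v)))
  rw [integral_map_equiv]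
  simp [sub_eq_neg_add]

theorem linearStatistic_add (hf : IsBoundedlySupported f) (hg : IsBoundedlySupported g)
    (p : LocFinMeasure n) :
    linearStatistic (f + g) p = linearStatistic f p + linearStatistic g p :=
  integral_add (hf.integrable p.1) (hg.integrable p.1)

theorem linearStatistic_smul (c : ℂ) (f : Euc n → ℂ) (p : LocFinMeasure n) :
    linearStatistic (c • f) p = c * linearStatistic f p :=
  integral_const_mul c f

theorem linearStatistic_sub (hf : IsBoundedlySupported f) (hg : IsBoundedlySupported g)
    (p : LocFinMeasure n) :
    linearStatistic (f - g) p = linearStatistic f p - linearStatistic g p :=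
  integral_sub (hf.integrable p.1) (hg.integrable p.1)

theorem norm_linearStatistic_le {M : ℝ} (hM : ∀ x, ‖f x‖ ≤ M) {R : ℝ}
    (hR : ∀ x, f x ≠ 0 → ‖x‖ ≤ R) (p : LocFinMeasure n) :
    ‖linearStatistic f p‖ ≤ M * p.1.real (Metric.closedBall 0 R) := by
  have : linearStatistic f p = ∫ x in Metric.closedBall 0 R, f x ∂p.1 :=
    (setIntegral_eq_integral_of_forall_compl_eq_zero fun x hx => by
      by_contra h; exact hx (by simpa using hR x h)).symm
  rw [this]
  exact norm_setIntegral_le_of_norm_le_const Metric.isBounded_closedBall.measure_lt_top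
    fun x _ => hM x

variable {μ : Measure (LocFinMeasure n)}

theorem memLp_measureReal (hμ : IsLocallySquareIntegrable μ) {B : Set (Euc n)}
    (hB : MeasurableSet B) (hb : Bornology.IsBounded B) :
    MemLp (fun p : LocFinMeasure n => p.1.real B) 2 μ := by
  refine ⟨(measurable_apply hB).ennreal_toReal.aestronglyMeasurable, ?_⟩
  rw [eLpNorm_lt_top_iff_lintegral_rpow_enorm_lt_top (by simp) (by simp)]
  refine lt_of_le_of_lt (lintegral_mono fun p => ?_) (hμ B hB hb)
  simp only [ENNReal.toReal_ofNat, ENNReal.rpow_ofNat]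
  rw [Real.enorm_of_nonneg measureReal_nonneg,
    ofReal_measureReal (measure_lt_top_of_isBounded p hb).ne]

theorem memLp_linearStatistic (hμ : IsLocallySquareIntegrable μ) (hf : IsBoundedlySupported f) :
    MemLp (linearStatistic f) 2 μ := by
  obtain ⟨M, -, hM⟩ := hf.exists_bound
  obtain ⟨R, -, hR⟩ := hf.exists_radius
  refine MemLp.of_le_mul (c := M) (memLp_measureReal hμ (Metric.isClosed_closedBall (x := 0) (ε := R)).measurableSet
    Metric.isBounded_closedBall)
    (stronglyMeasurable_linearStatistic hf.measurable).aestronglyMeasurable (.of_forall fun p => ?_)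
  rw [Real.norm_of_nonneg measureReal_nonneg]
  exact norm_linearStatistic_le hM hR p

theorem measurePreserving_translateMeasure (hi : IsInvariant μ) (v : Euc n) :
    MeasurePreserving (translateMeasure v) μ μ :=
  ⟨measurable_translateMeasure v, hi v⟩

theorem integral_linearStatistic_shift (hi : IsInvariant μ) (v : Euc n) (hf : Measurable f) :
    ∫ p, linearStatistic (shift v f) p ∂μ = ∫ p, linearStatistic f p ∂μ := by
  simp_rw [linearStatistic_shift]
  have h := measurePreserving_translateMeasure hi (-v)
  conv_rhs => rw [← h.map_eq]
  rw [integral_map h.measurable.aemeasurable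
    (stronglyMeasurable_linearStatistic hf).aestronglyMeasurable]

/-- The class of a linear statistic in `L²(μ)`. -/
def stat (hμ : IsLocallySquareIntegrable μ) (hf : IsBoundedlySupported f) : Lp ℂ 2 μ :=
  (memLp_linearStatistic hμ hf).toLp _

theorem statCov_shift_shift (hi : IsInvariant μ) (hf : Measurable f) (hg : Measurable g)
    (v : Euc n) : statCov μ (shift v f) (shift v g) = statCov μ f g := by
  unfold statCov
  rw [integral_linearStatistic_shift hi v hf, integral_linearStatistic_shift hi v hg]
  simp_rw [linearStatistic_shift]
  have h := measurePreserving_translateMeasure hi (-v)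
  conv_rhs => rw [← h.map_eq]
  rw [integral_map h.measurable.aemeasurable]
  · rw [h.map_eq]
  · refine AEStronglyMeasurable.mul ?_ (Complex.continuous_conj.comp_aestronglyMeasurable ?_)
    · exact ((stronglyMeasurable_linearStatistic hf).sub stronglyMeasurable_const).aestronglyMeasurable
    · exact ((stronglyMeasurable_linearStatistic hg).sub stronglyMeasurable_const).aestronglyMeasurable

variable [IsProbabilityMeasure μ]

theorem memLp_centered (hμ : IsLocallySquareIntegrable μ) (hf : IsBoundedlySupported f) :
    MemLp (fun p => linearStatistic f p - ∫ q, linearStatistic f q ∂μ) 2 μ :=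
  (memLp_linearStatistic hμ hf).sub (memLp_const _)

/-- The class of a centered linear statistic in `L²(μ)`. -/
def centeredStat (hμ : IsLocallySquareIntegrable μ) (hf : IsBoundedlySupported f) : Lp ℂ 2 μ :=
  (memLp_centered hμ hf).toLp _

/-- The arguments are exchanged because the inner product is conjugate-linear in its first slot,
whereas the covariance conjugates the second. -/
theorem statCov_eq_inner (hμ : IsLocallySquareIntegrable μ) (hf : IsBoundedlySupported f)
    (hg : IsBoundedlySupported g) :
    statCov μ f g = inner ℂ (centeredStat hμ hg) (centeredStat hμ hf) := by
  rw [L2.inner_def, statCov]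
  refine integral_congr_ae ?_
  filter_upwards [(memLp_centered hμ hf).coeFn_toLp, (memLp_centered hμ hg).coeFn_toLp] with p h1 h2
  rw [centeredStat, centeredStat, h1, h2, RCLike.inner_apply]

theorem shift_shift (v w : Euc n) (f : Euc n → ℂ) : shift v (shift w f) = shift (v + w) f := by
  ext x
  simp [shift, sub_sub]

theorem shift_zero (f : Euc n → ℂ) : shift 0 f = f := by
  ext x
  simp [shift]

end RandomMeasure

end

/-! ### Continuity of translations in `L²(μ)` and spectral measures. -/

noncomputable section

namespace RandomMeasure

open Filter Topology Set

variable {n : ℕ} {f g : Euc n → ℂ} {μ : Measure (LocFinMeasure n)}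

theorem norm_stat (hμ : IsLocallySquareIntegrable μ) (hf : IsBoundedlySupported f) :
    ‖stat hμ hf‖ = (eLpNorm (linearStatistic f) 2 μ).toReal := Lp.norm_toLp _ _

theorem norm_stat_shift (hμ : IsLocallySquareIntegrable μ) (hi : IsInvariant μ)
    (hf : IsBoundedlySupported f) (v : Euc n) : ‖stat hμ (hf.shift v)‖ = ‖stat hμ hf‖ := by
  rw [norm_stat, norm_stat, ← eLpNorm_comp_measurePreserving
    (stronglyMeasurable_linearStatistic hf.measurable).aestronglyMeasurable
    (measurePreserving_translateMeasure hi (-v))]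
  congr 2
  ext p
  exact linearStatistic_shift v f p

theorem stat_sub (hμ : IsLocallySquareIntegrable μ) (hf : IsBoundedlySupported f)
    (hg : IsBoundedlySupported g) : stat hμ (hf.sub hg) = stat hμ hf - stat hμ hg := by
  unfold stat
  rw [← MemLp.toLp_sub]
  exact MemLp.toLp_congr _ _ (.of_forall fun p => linearStatistic_sub hf hg p)

theorem norm_stat_le (hμ : IsLocallySquareIntegrable μ) (hf : IsBoundedlySupported f) {M : ℝ}
    (hM : ∀ x, ‖f x‖ ≤ M) {R : ℝ} (hR : ∀ x, f x ≠ 0 → ‖x‖ ≤ R) :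
    ‖stat hμ hf‖ ≤
      M * (eLpNorm (fun p : LocFinMeasure n => p.1.real (Metric.closedBall 0 R)) 2 μ).toReal := by
  have hM0 : 0 ≤ M := (norm_nonneg _).trans (hM 0)
  have h := memLp_measureReal hμ (Metric.isClosed_closedBall (x := (0 : Euc n)) (ε := R)).measurableSet
    Metric.isBounded_closedBall
  rw [norm_stat, ← ENNReal.toReal_ofReal hM0, ← ENNReal.toReal_mul]
  refine ENNReal.toReal_mono (ENNReal.mul_ne_top ENNReal.ofReal_ne_top h.2.ne) ?_
  refine eLpNorm_le_mul_eLpNorm_of_ae_le_mul (.of_forall fun p => ?_) 2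
  rw [Real.norm_of_nonneg measureReal_nonneg]
  exact norm_linearStatistic_le hM hR p

/-- A compactly supported continuous function is uniformly continuous, so nearby translates are
uniformly close. For `‖v - v₀‖ < 1` their difference lives in one fixed ball, whose mass is
square-integrable. -/
theorem continuous_stat_shift_of_continuous (hμ : IsLocallySquareIntegrable μ)
    (hf : IsBoundedlySupported f) (hc : Continuous f) :
    Continuous fun v => stat hμ (hf.shift v) := by
  obtain ⟨R, hR0, hR⟩ := hf.exists_radius
  have hcs : HasCompactSupport f := HasCompactSupport.of_support_subset_isCompact
    (isCompact_closedBall (0 : Euc n) R) fun x hx => by simpa using hR x hx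
  have huc : UniformContinuous f := hcs.uniformContinuous_of_continuous hc
  rw [Metric.continuous_iff]
  intro v₀ ε hε
  set N := (eLpNorm (fun p : LocFinMeasure n =>
    p.1.real (Metric.closedBall 0 (R + ‖v₀‖ + 1))) 2 μ).toReal
  have hN : 0 ≤ N := ENNReal.toReal_nonneg
  obtain ⟨δ, hδ, h⟩ := Metric.uniformContinuous_iff.1 huc (ε / (2 * (N + 1))) (by positivity)
  refine ⟨min δ 1, lt_min hδ one_pos, fun v hv => ?_⟩
  rw [dist_eq_norm, ← stat_sub]
  refine (norm_stat_le hμ _ (M := ε / (2 * (N + 1))) (R := R + ‖v₀‖ + 1) (fun x => ?_)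
    fun x hx => ?_).trans_lt ?_
  · refine le_of_lt ?_
    rw [Pi.sub_apply, ← dist_eq_norm]
    refine h ?_
    rw [dist_sub_left]
    exact hv.trans_le (min_le_left _ _)
  · have hv1 : ‖v‖ ≤ ‖v₀‖ + 1 := by
      have h1 : ‖v - v₀‖ < 1 := by rw [← dist_eq_norm]; exact hv.trans_le (min_le_right _ _)
      have := norm_sub_norm_le v v₀
      linarith
    by_contra hlt
    push Not at hlt
    refine hx ?_
    have key : ∀ w : Euc n, ‖w‖ ≤ ‖v₀‖ + 1 → shift w f x = 0 := fun w hw => by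
      by_contra hne
      have h1 := hR _ hne
      have h2 := norm_add_le (x - w) w
      rw [sub_add_cancel] at h2
      linarith
    rw [Pi.sub_apply, key v hv1, key v₀ (by linarith), sub_zero]
  · rw [div_mul_eq_mul_div, div_lt_iff₀ (by positivity)]
    nlinarith

/-- The measure `A ↦ ∫ p(B) p(A ∩ B) dμ(p)`. -/
def secondMoment (μ : Measure (LocFinMeasure n)) (B : Set (Euc n)) : Measure (Euc n) :=
  (μ.withDensity fun p => p.1 B).bind fun p => p.1.restrict B

theorem lintegral_secondMoment {B : Set (Euc n)} (hB : MeasurableSet B) {h : Euc n → ENNReal}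
    (hh : Measurable h) :
    ∫⁻ x, h x ∂(secondMoment μ B) = ∫⁻ p, p.1 B * ∫⁻ x in B, h x ∂p.1 ∂μ := by
  have hm : Measurable fun p : LocFinMeasure n => p.1.restrict B := by
    refine Measure.measurable_of_measurable_coe _ fun t ht => ?_
    simp only [Measure.restrict_apply ht]
    exact measurable_apply (ht.inter hB)
  rw [secondMoment, Measure.lintegral_bind hm.aemeasurable hh.aemeasurable,
    lintegral_withDensity_eq_lintegral_mul _ (measurable_apply hB)
      (g := fun p => ∫⁻ x in B, h x ∂p.1) ((Measure.measurable_lintegral hh).comp hm)]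
  rfl

theorem isFiniteMeasure_secondMoment (hμ : IsLocallySquareIntegrable μ) {B : Set (Euc n)}
    (hB : MeasurableSet B) (hb : Bornology.IsBounded B) : IsFiniteMeasure (secondMoment μ B) := by
  refine ⟨?_⟩
  rw [← lintegral_one, lintegral_secondMoment hB measurable_const]
  simp only [lintegral_one, Measure.restrict_apply_univ, ← sq]
  exact hμ B hB hb

/-- Cauchy–Schwarz for each `p` gives `|∫_B f dp|² ≤ p(B) ∫_B |f|² dp`; integrating over `μ`
produces the second-moment measure. This reduces approximation of statistics to approximation of
functions in an ordinary `L²` space. -/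
theorem norm_stat_le_secondMoment (hμ : IsLocallySquareIntegrable μ) (hf : IsBoundedlySupported f)
    {R : ℝ} (hR : ∀ x, f x ≠ 0 → ‖x‖ ≤ R) :
    ‖stat hμ hf‖ ≤ (eLpNorm f 2 (secondMoment μ (Metric.closedBall 0 R))).toReal := by
  set B : Set (Euc n) := Metric.closedBall 0 R with hBdef
  have hB : MeasurableSet B := Metric.isClosed_closedBall.measurableSet
  have hfin := isFiniteMeasure_secondMoment hμ hB Metric.isBounded_closedBall
  have hfm : MemLp f 2 (secondMoment μ B) := by
    obtain ⟨M, hM⟩ := hf.bounded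
    exact MemLp.of_bound hf.measurable.aestronglyMeasurable M (.of_forall hM)
  rw [norm_stat]
  refine ENNReal.toReal_mono hfm.2.ne ?_
  rw [eLpNorm_eq_lintegral_rpow_enorm_toReal (by simp) (by simp),
    eLpNorm_eq_lintegral_rpow_enorm_toReal (by simp) (by simp)]
  refine ENNReal.rpow_le_rpow ?_ (by positivity)
  simp only [ENNReal.toReal_ofNat, ENNReal.rpow_ofNat]
  rw [lintegral_secondMoment hB (hf.measurable.enorm.pow_const 2)]
  refine lintegral_mono fun p => ?_
  have h1 : linearStatistic f p = ∫ x in B, f x ∂p.1 :=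
    (setIntegral_eq_integral_of_forall_compl_eq_zero fun x hx => by
      by_contra h; exact hx (by simpa [hBdef] using hR x h)).symm
  have h2 : ‖linearStatistic f p‖ₑ ≤ ∫⁻ x in B, ‖f x‖ₑ ∂p.1 := by
    rw [h1]; exact enorm_integral_le_lintegral_enorm _
  have h3 := ENNReal.lintegral_mul_le_Lp_mul_Lq (p.1.restrict B) Real.HolderConjugate.two_two
    (f := fun _ => 1) (g := fun x => ‖f x‖ₑ) aemeasurable_const hf.measurable.enorm.aemeasurable
  simp only [Pi.mul_apply, one_mul, ENNReal.rpow_ofNat, one_pow, lintegral_one,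
    Measure.restrict_apply_univ] at h3
  calc ‖linearStatistic f p‖ₑ ^ 2
      ≤ ((p.1 B) ^ (1 / 2 : ℝ) * (∫⁻ x in B, ‖f x‖ₑ ^ 2 ∂p.1) ^ (1 / 2 : ℝ)) ^ 2 := by
        gcongr
        exact h2.trans h3
    _ = p.1 B * ∫⁻ x in B, ‖f x‖ₑ ^ 2 ∂p.1 := by
        rw [mul_pow, ← ENNReal.rpow_natCast, ← ENNReal.rpow_natCast, ← ENNReal.rpow_mul,
          ← ENNReal.rpow_mul]
        norm_num

/-- Continuous functions are dense in `L²` of the second-moment measure. By invariance of `μ`, the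
error of approximating the statistic is the same for all translates, so the continuous case passes
to a uniform limit. -/
theorem continuous_stat_shift (hμ : IsLocallySquareIntegrable μ) (hi : IsInvariant μ)
    (hf : IsBoundedlySupported f) : Continuous fun v => stat hμ (hf.shift v) := by
  obtain ⟨R, hR0, hR⟩ := hf.exists_radius
  obtain ⟨M, hM⟩ := hf.bounded
  refine continuous_of_uniform_approx_of_continuous fun u hu => ?_
  obtain ⟨ε, hε, hεu⟩ := Metric.mem_uniformity_dist.1 hu
  have hB : MeasurableSet (Metric.closedBall (0 : Euc n) (R + 1)) :=
    Metric.isClosed_closedBall.measurableSet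
  have hfin := isFiniteMeasure_secondMoment hμ hB Metric.isBounded_closedBall
  set ρ := secondMoment μ (Metric.closedBall (0 : Euc n) (R + 1)) with hρ
  have hfm : MemLp f 2 ρ := MemLp.of_bound hf.measurable.aestronglyMeasurable M (.of_forall hM)
  obtain ⟨g, hgs, hgf, hgc, -⟩ := hfm.exists_hasCompactSupport_eLpNorm_sub_le (by simp)
    (ε := ENNReal.ofReal (ε / 2)) (by simpa using hε)
  obtain ⟨N, hN⟩ := hgs.exists_bound_of_continuous hgc
  -- The cutoff confines the approximant to the ball of radius `R + 1`. It equals `1` where `f` may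
  -- be nonzero, so it does not increase the distance to `f`.
  set χ : Euc n → ℝ := fun x => max 0 (min 1 (R + 1 - ‖x‖)) with hχ
  have hχc : Continuous χ := by rw [hχ]; fun_prop
  have hχ0 : ∀ x, 0 ≤ χ x := fun x => le_max_left _ _
  have hχ1 : ∀ x, χ x ≤ 1 := fun x => max_le zero_le_one (min_le_left _ _)
  have hχin : ∀ x, ‖x‖ ≤ R → χ x = 1 := fun x hx => by
    simp only [hχ]
    rw [min_eq_left (by linarith), max_eq_right zero_le_one]
  have hχout : ∀ x, R + 1 < ‖x‖ → χ x = 0 := fun x hx => by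
    simp only [hχ]
    rw [min_eq_right (by linarith), max_eq_left (by linarith)]
  set h : Euc n → ℂ := fun x => χ x * g x with hh
  have hhc : Continuous h := by rw [hh]; fun_prop
  have hhR : ∀ x, h x ≠ 0 → ‖x‖ ≤ R + 1 := fun x hx => by
    by_contra hlt
    push Not at hlt
    exact hx (by simp [hh, hχout x hlt])
  have hhb : IsBoundedlySupported h := .of_radius hhc.measurable (M := N) (fun x => by
    simp only [hh]
    rw [norm_mul, Complex.norm_real, Real.norm_of_nonneg (hχ0 x)]
    exact (mul_le_of_le_one_left (norm_nonneg _) (hχ1 x)).trans (hN x)) hhR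
  refine ⟨fun v => stat hμ (hhb.shift v), continuous_stat_shift_of_continuous hμ hhb hhc,
    fun v => hεu ?_⟩
  rw [dist_eq_norm, ← stat_sub]
  have h1 : ‖stat hμ ((hf.shift v).sub (hhb.shift v))‖ = ‖stat hμ (hf.sub hhb)‖ :=
    norm_stat_shift hμ hi (hf.sub hhb) v
  rw [h1]
  refine (norm_stat_le_secondMoment hμ (hf.sub hhb) (R := R + 1) fun x hx => ?_).trans_lt ?_
  · by_contra hlt
    push Not at hlt
    refine hx ?_
    have hfx : f x = 0 := by
      by_contra hne
      linarith [hR x hne]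
    rw [Pi.sub_apply, hfx, hh]
    simp [hχout x hlt]
  · have h2 : eLpNorm (f - h) 2 ρ ≤ eLpNorm (f - g) 2 ρ := by
      refine eLpNorm_mono fun x => ?_
      rw [Pi.sub_apply, Pi.sub_apply]
      by_cases hx : ‖x‖ ≤ R
      · simp [hh, hχin x hx]
      · have hfx : f x = 0 := by
          by_contra hne
          exact hx (hR x hne)
        rw [hfx, zero_sub, zero_sub, norm_neg, norm_neg, hh]
        simp only []
        rw [norm_mul, Complex.norm_real, Real.norm_of_nonneg (hχ0 x)]
        exact mul_le_of_le_one_left (norm_nonneg _) (hχ1 x)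
    have h3 := ENNReal.toReal_mono ENNReal.ofReal_ne_top (h2.trans hgf)
    rw [ENNReal.toReal_ofReal (by positivity)] at h3
    rw [← hρ]
    linarith

variable [IsProbabilityMeasure μ]

theorem continuous_centeredStat_shift (hμ : IsLocallySquareIntegrable μ) (hi : IsInvariant μ)
    (hf : IsBoundedlySupported f) : Continuous fun v => centeredStat hμ (hf.shift v) := by
  have h : ∀ v, centeredStat hμ (hf.shift v) = stat hμ (hf.shift v) -
      (memLp_const (∫ p, linearStatistic f p ∂μ)).toLp _ := by
    intro v
    unfold centeredStat stat
    rw [← MemLp.toLp_sub]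
    refine MemLp.toLp_congr _ _ (.of_forall fun p => ?_)
    simp only [Pi.sub_apply]
    rw [integral_linearStatistic_shift hi v hf.measurable]
  simp_rw [h]
  exact (continuous_stat_shift hμ hi hf).sub continuous_const

/-- The covariance function of a linear statistic along its translates is the characteristic
function of a finite measure. -/
theorem exists_spectralMeasure (hμ : IsLocallySquareIntegrable μ) (hi : IsInvariant μ)
    (hf : IsBoundedlySupported f) :
    ∃ m : Measure (Euc n), IsFiniteMeasure m ∧ ∀ v w, statCov μ (shift v f) (shift w f) =
      charFun m (w - v) := by
  have hcov : ∀ v w, statCov μ (shift v f) (shift w f) = statCov μ f (shift (w - v) f) := by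
    intro v w
    rw [← statCov_shift_shift hi hf.measurable (hf.shift (w - v)).measurable v, shift_shift,
      add_sub_cancel]
  obtain ⟨m, hm, hchar⟩ := exists_charFun_eq_of_stationary
    (continuous_centeredStat_shift hμ hi hf) (k := fun v => statCov μ f (shift v f))
    fun v w => by rw [← statCov_eq_inner, hcov]
  exact ⟨m, hm, fun v w => by rw [hchar, hcov]⟩

end RandomMeasure

end

/-! ### Convolutions and the comparison of spectral measures. -/

noncomputable section

namespace RandomMeasure

open Filter Topology Set

variable {n : ℕ} {f g h : Euc n → ℂ} {μ : Measure (LocFinMeasure n)}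

/-! ### Convolutions -/

/-- The convolution of two functions on `ℝⁿ`. -/
def conv (f g : Euc n → ℂ) : Euc n → ℂ := fun x => ∫ a, g a * f (x - a)

theorem conv_comm (f g : Euc n → ℂ) : conv f g = conv g f := by
  ext x
  unfold conv
  rw [← integral_sub_left_eq_self _ _ x]
  simp [mul_comm]

theorem shift_conv (v : Euc n) (f g : Euc n → ℂ) : shift v (conv f g) = conv (shift v f) g := by
  ext x
  simp only [shift, conv, sub_right_comm]

/-- A common bound for the translates of `f` by the vectors of the support of `g`. -/
theorem norm_le_of_mem_support {Rf Rg : ℝ} (hRf : ∀ x, f x ≠ 0 → ‖x‖ ≤ Rf)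
    (hRg : ∀ x, g x ≠ 0 → ‖x‖ ≤ Rg) {a : Euc n} (ha : g a ≠ 0) (x : Euc n)
    (hx : shift a f x ≠ 0) : ‖x‖ ≤ Rf + Rg := by
  have h1 := hRf _ hx
  have h2 := hRg _ ha
  have h3 := norm_add_le (x - a) a
  rw [sub_add_cancel] at h3
  linarith

theorem IsBoundedlySupported.conv (hf : IsBoundedlySupported f) (hg : IsBoundedlySupported g) :
    IsBoundedlySupported (conv f g) := by
  obtain ⟨M, -, hM⟩ := hf.exists_bound
  obtain ⟨Rf, -, hRf⟩ := hf.exists_radius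
  obtain ⟨Rg, -, hRg⟩ := hg.exists_radius
  refine .of_radius (M := ∫ a, ‖g a‖ * M) (R := Rf + Rg) ?_ (fun x => ?_) (fun x hx => ?_)
  · have hm : Measurable fun q : Euc n × Euc n => g q.2 * f (q.1 - q.2) :=
      (hg.measurable.comp measurable_snd).mul
        (hf.measurable.comp (measurable_fst.sub measurable_snd))
    exact (hm.stronglyMeasurable.integral_prod_right').measurable
  · refine (norm_integral_le_integral_norm _).trans
      (integral_mono_of_nonneg (.of_forall fun a => norm_nonneg _)
        ((hg.integrable volume).norm.mul_const M) (.of_forall fun a => ?_))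
    simp only [norm_mul]
    gcongr
    exact hM _
  · by_contra hlt
    refine hx ((integral_congr_ae (.of_forall fun a => ?_)).trans (integral_zero _ _))
    by_contra hne
    have hne' := mul_ne_zero_iff.1 hne
    exact hlt (norm_le_of_mem_support hRf hRg hne'.1 x hne'.2)

theorem linearStatistic_conv (hf : IsBoundedlySupported f) (hg : IsBoundedlySupported g)
    (p : LocFinMeasure n) :
    linearStatistic (conv f g) p = ∫ a, g a * linearStatistic (shift a f) p := by
  obtain ⟨M, hM0, hM⟩ := hf.exists_bound
  obtain ⟨Rf, -, hRf⟩ := hf.exists_radius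
  obtain ⟨Rg, -, hRg⟩ := hg.exists_radius
  unfold linearStatistic conv
  have hint : Integrable (fun q : Euc n × Euc n => g q.2 * f (q.1 - q.2)) (p.1.prod volume) := by
    have hm : Measurable fun q : Euc n × Euc n => g q.2 * f (q.1 - q.2) :=
      (hg.measurable.comp measurable_snd).mul
        (hf.measurable.comp (measurable_fst.sub measurable_snd))
    have hball : Integrable ((Metric.closedBall (0 : Euc n) (Rf + Rg)).indicator fun _ => M) p.1 :=
      (integrable_indicator_iff Metric.isClosed_closedBall.measurableSet).2
        (integrableOn_const Metric.isBounded_closedBall.measure_lt_top.ne)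
    refine (hball.mul_prod (hg.integrable volume).norm).mono' hm.aestronglyMeasurable
      (.of_forall fun q => ?_)
    by_cases hq : g q.2 * f (q.1 - q.2) = 0
    · rw [hq, norm_zero]
      exact mul_nonneg (indicator_nonneg (fun _ _ => hM0) _) (norm_nonneg _)
    · have hne := mul_ne_zero_iff.1 hq
      have := norm_le_of_mem_support hRf hRg hne.1 q.1 hne.2
      rw [indicator_of_mem (by simpa using this), norm_mul, mul_comm]
      gcongr
      exact hM _
  rw [integral_integral_swap (f := fun x a => g a * f (x - a)) hint]
  refine integral_congr_ae (.of_forall fun a => ?_)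
  simp only [shift]
  exact integral_const_mul _ _

theorem statCov_conj_symm (μ : Measure (LocFinMeasure n)) (f g : Euc n → ℂ) :
    conj (statCov μ g f) = statCov μ f g := by
  unfold statCov
  rw [← integral_conj]
  refine integral_congr_ae (.of_forall fun p => ?_)
  simp only [map_mul, Complex.conj_conj]
  ring

section Fourier

theorem norm_exp_neg_I_inner (x ξ : Euc n) :
    ‖Complex.exp (-(Complex.I * ((inner ℝ x ξ : ℝ) : ℂ)))‖ = 1 := by
  rw [Complex.norm_exp]
  simp

theorem integrable_fourierTransform_integrand (hf : IsBoundedlySupported f) (ξ : Euc n) :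
    Integrable fun x => f x * Complex.exp (-(Complex.I * ((inner ℝ x ξ : ℝ) : ℂ))) := by
  refine (hf.integrable volume).norm.mono' ?_ (.of_forall fun x => ?_)
  · exact hf.measurable.aestronglyMeasurable.mul (Continuous.aestronglyMeasurable (by fun_prop))
  · rw [norm_mul, norm_exp_neg_I_inner, mul_one]

theorem norm_fourierTransform_le (f : Euc n → ℂ) (ξ : Euc n) :
    ‖fourierTransform f ξ‖ ≤ ∫ x, ‖f x‖ := by
  refine (norm_integral_le_integral_norm _).trans (le_of_eq ?_)
  simp [norm_exp_neg_I_inner]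

theorem continuous_fourierTransform (hf : IsBoundedlySupported f) :
    Continuous (fourierTransform f) := by
  refine continuous_of_dominated (bound := fun x => ‖f x‖)
    (fun ξ => (integrable_fourierTransform_integrand hf ξ).aestronglyMeasurable)
    (fun ξ => .of_forall fun x => ?_) (hf.integrable volume).norm (.of_forall fun x => by fun_prop)
  rw [norm_mul, norm_exp_neg_I_inner, mul_one]

theorem fourierTransform_add (hf : IsBoundedlySupported f) (hg : IsBoundedlySupported g) :
    fourierTransform (f + g) = fourierTransform f + fourierTransform g := by
  ext ξ
  simp only [fourierTransform, Pi.add_apply, add_mul]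
  exact integral_add (integrable_fourierTransform_integrand hf ξ)
    (integrable_fourierTransform_integrand hg ξ)

theorem fourierTransform_smul (c : ℂ) (f : Euc n → ℂ) :
    fourierTransform (c • f) = c • fourierTransform f := by
  ext ξ
  simp only [fourierTransform, Pi.smul_apply, smul_eq_mul, mul_assoc]
  exact integral_const_mul _ _

theorem fourierTransform_shift (v : Euc n) (f : Euc n → ℂ) (ξ : Euc n) :
    fourierTransform (shift v f) ξ =
      Complex.exp (-(Complex.I * ((inner ℝ v ξ : ℝ) : ℂ))) * fourierTransform f ξ := by
  unfold fourierTransform shift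
  rw [← integral_add_right_eq_self _ v, ← integral_const_mul]
  refine integral_congr_ae (.of_forall fun x => ?_)
  simp only [add_sub_cancel_right, inner_add_left, Complex.ofReal_add, mul_add, neg_add,
    Complex.exp_add]
  ring

/-- Fubini's theorem for the Fourier transform against a bounded function. -/
theorem integral_mul_integral_exp (hg : IsBoundedlySupported g) (m : Measure (Euc n))
    [IsFiniteMeasure m] {Q : Euc n → ℂ} (hQ : Measurable Q) {M : ℝ} (hM : ∀ ξ, ‖Q ξ‖ ≤ M) :
    ∫ a, g a * ∫ ξ, Complex.exp (-(Complex.I * ((inner ℝ a ξ : ℝ) : ℂ))) * Q ξ ∂m =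
      ∫ ξ, fourierTransform g ξ * Q ξ ∂m := by
  have hint : Integrable (fun q : Euc n × Euc n =>
      g q.1 * (Complex.exp (-(Complex.I * ((inner ℝ q.1 q.2 : ℝ) : ℂ))) * Q q.2))
      (volume.prod m) := by
    refine ((hg.integrable volume).norm.mul_prod (integrable_const (μ := m) M)).mono' ?_
      (.of_forall fun q => ?_)
    · refine Measurable.aestronglyMeasurable ?_
      exact (hg.measurable.comp measurable_fst).mul
        ((Continuous.measurable (by fun_prop)).mul (hQ.comp measurable_snd))
    · rw [norm_mul, norm_mul, norm_exp_neg_I_inner, one_mul]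
      gcongr
      exact hM _
  simp_rw [← integral_const_mul]
  rw [integral_integral_swap (f := fun a ξ =>
    g a * (Complex.exp (-(Complex.I * ((inner ℝ a ξ : ℝ) : ℂ))) * Q ξ)) hint]
  refine integral_congr_ae (.of_forall fun ξ => ?_)
  simp only [fourierTransform, ← mul_assoc]
  exact integral_mul_const _ _

end Fourier

variable [IsProbabilityMeasure μ]

/-- The centred right factor has mean zero, so the left one need not be centred. The formula is then
linear in the raw statistic, ready for Fubini. -/
theorem statCov_eq_integral_mul (hμ : IsLocallySquareIntegrable μ) (hf : IsBoundedlySupported f)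
    (hg : IsBoundedlySupported g) :
    statCov μ f g = ∫ p, linearStatistic f p *
      conj (linearStatistic g p - ∫ q, linearStatistic g q ∂μ) ∂μ := by
  have hgc := memLp_centered hμ hg
  have hgcc : MemLp (fun p => conj (linearStatistic g p - ∫ q, linearStatistic g q ∂μ)) 2 μ :=
    hgc.star
  have h1 : Integrable (fun p => linearStatistic f p *
      conj (linearStatistic g p - ∫ q, linearStatistic g q ∂μ)) μ :=
    (memLp_linearStatistic hμ hf).integrable_mul hgcc
  have h2 : Integrable (fun p => (∫ q, linearStatistic f q ∂μ) *
      conj (linearStatistic g p - ∫ q, linearStatistic g q ∂μ)) μ :=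
    (hgcc.integrable (by norm_num)).const_mul _
  unfold statCov
  simp_rw [sub_mul _ _ (conj _)]
  rw [integral_sub h1 h2, integral_const_mul, integral_conj,
    integral_sub ((memLp_linearStatistic hμ hg).integrable (by norm_num)) (integrable_const _)]
  simp

/-- Fubini applies because, for `a` in the support of `g`, all the statistics of `shift a f` are
dominated by one multiple of the mass of a fixed ball. -/
theorem statCov_conv_left (hμ : IsLocallySquareIntegrable μ) (hf : IsBoundedlySupported f)
    (hg : IsBoundedlySupported g) (hh : IsBoundedlySupported h) :
    statCov μ (conv f g) h = ∫ a, g a * statCov μ (shift a f) h := by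
  obtain ⟨M, hM0, hM⟩ := hf.exists_bound
  obtain ⟨Rf, -, hRf⟩ := hf.exists_radius
  obtain ⟨Rg, -, hRg⟩ := hg.exists_radius
  set Y : LocFinMeasure n → ℂ := fun p => conj (linearStatistic h p - ∫ q, linearStatistic h q ∂μ)
  have hY : MemLp Y 2 μ := (memLp_centered hμ hh).star
  have hYm : Measurable Y := by
    refine Complex.continuous_conj.measurable.comp ?_
    exact (stronglyMeasurable_linearStatistic hh.measurable).measurable.sub_const _
  rw [statCov_eq_integral_mul hμ (hf.conv hg) hh]
  simp_rw [fun a => statCov_eq_integral_mul hμ (hf.shift a) hh, ← integral_const_mul,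
    linearStatistic_conv hf hg, ← integral_mul_const]
  have hint : Integrable (fun q : LocFinMeasure n × Euc n =>
      g q.2 * linearStatistic (shift q.2 f) q.1 * Y q.1) (μ.prod volume) := by
    have hB := memLp_measureReal hμ
      (Metric.isClosed_closedBall (x := (0 : Euc n)) (ε := Rf + Rg)).measurableSet
      Metric.isBounded_closedBall
    have hdom := ((hB.integrable_mul hY.norm).const_mul M).mul_prod (hg.integrable volume).norm
    refine hdom.mono' ?_ (.of_forall fun q => ?_)
    · refine Measurable.aestronglyMeasurable ?_
      exact ((hg.measurable.comp measurable_snd).mul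
        ((stronglyMeasurable_linearStatistic_shift hf.measurable).measurable.comp
          measurable_swap)).mul (hYm.comp measurable_fst)
    · by_cases hq : g q.2 = 0
      · simp [hq]
      · have h1 := norm_linearStatistic_le (f := shift q.2 f) (fun x => hM _)
          (norm_le_of_mem_support hRf hRg hq) q.1
        rw [norm_mul, norm_mul, Pi.mul_apply]
        calc ‖g q.2‖ * ‖linearStatistic (shift q.2 f) q.1‖ * ‖Y q.1‖
            ≤ ‖g q.2‖ * (M * q.1.1.real (Metric.closedBall 0 (Rf + Rg))) * ‖Y q.1‖ := by gcongr
          _ = _ := by ring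
  rw [integral_integral_swap (f := fun p a => g a * linearStatistic (shift a f) p * Y p) hint]
  simp_rw [mul_assoc]
  rfl

theorem statCov_conv_right (hμ : IsLocallySquareIntegrable μ) (hf : IsBoundedlySupported f)
    (hg : IsBoundedlySupported g) (hh : IsBoundedlySupported h) :
    statCov μ h (conv f g) = ∫ a, conj (g a) * statCov μ h (shift a f) := by
  rw [← statCov_conj_symm, statCov_conv_left hμ hf hg hh, ← integral_conj]
  refine integral_congr_ae (.of_forall fun a => ?_)
  simp only [map_mul, statCov_conj_symm]

/-- Each convolution by `g` integrates the characters of `m` against `g` or its conjugate, producing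
the factors `ĝ` and `conj ĝ`. The left side is symmetric in `f` and `g` although the right side is
not; this asymmetry yields the comparison of spectral measures. -/
theorem statCov_conv_conv (hμ : IsLocallySquareIntegrable μ)
    (hf : IsBoundedlySupported f) (hg : IsBoundedlySupported g) {m : Measure (Euc n)}
    [IsFiniteMeasure m] (hm : ∀ v w, statCov μ (shift v f) (shift w f) = charFun m (w - v))
    (w : Euc n) :
    statCov μ (conv f g) (shift w (conv f g)) =
      ∫ ξ, Complex.exp (((inner ℝ ξ w : ℝ) : ℂ) * Complex.I) *
        ((‖fourierTransform g ξ‖ ^ 2 : ℝ) : ℂ) ∂m := by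
  have hgc := continuous_fourierTransform hg
  rw [shift_conv, statCov_conv_left hμ hf hg ((hf.shift w).conv hg)]
  have hinner : ∀ a, statCov μ (shift a f) (conv (shift w f) g) =
      ∫ ξ, Complex.exp (-(Complex.I * ((inner ℝ a ξ : ℝ) : ℂ))) *
        (Complex.exp (((inner ℝ ξ w : ℝ) : ℂ) * Complex.I) * conj (fourierTransform g ξ)) ∂m := by
    intro a
    rw [statCov_conv_right hμ (hf.shift w) hg (hf.shift a)]
    have h1 := integral_mul_integral_exp hg m (M := 1)
      (Q := fun ξ => Complex.exp (((inner ℝ ξ (a - w) : ℝ) : ℂ) * Complex.I))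
      (Continuous.measurable (by fun_prop)) (fun ξ => (Complex.norm_exp_ofReal_mul_I _).le)
    have h2 := congrArg conj h1
    rw [← integral_conj, ← integral_conj] at h2
    refine (integral_congr_ae (.of_forall fun b => ?_)).trans
      (h2.trans (integral_congr_ae (.of_forall fun ξ => ?_)))
    · simp only [map_mul, shift_shift, hm]
      rw [charFun_apply, ← integral_conj]
      congr 1
      refine integral_congr_ae (.of_forall fun ξ => ?_)
      beta_reduce
      rw [← Complex.exp_add, ← Complex.exp_conj]
      simp only [map_add, map_mul, map_neg, Complex.conj_ofReal, Complex.conj_I,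
        inner_sub_right, inner_add_right, real_inner_comm b ξ]
      congr 1
      push_cast
      ring
    · simp only [map_mul, ← Complex.exp_conj, Complex.conj_ofReal, Complex.conj_I]
      rw [mul_comm, ← mul_assoc, ← Complex.exp_add, inner_sub_right, real_inner_comm a ξ]
      congr 2
      push_cast
      ring
  simp_rw [hinner]
  rw [integral_mul_integral_exp hg m (M := ∫ x, ‖g x‖)]
  · refine integral_congr_ae (.of_forall fun ξ => ?_)
    simp only []
    rw [mul_left_comm, Complex.mul_conj, Complex.normSq_eq_norm_sq]
  · exact Continuous.measurable (by
      have := Complex.continuous_conj.comp hgc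
      simp only [Function.comp_def] at this
      fun_prop)
  · intro ξ
    rw [norm_mul, Complex.norm_exp_ofReal_mul_I, one_mul, RCLike.norm_conj]
    exact norm_fourierTransform_le g ξ

/-- The squared modulus of the Fourier transform, as a density. -/
def spectralWeight (f : Euc n → ℂ) (ξ : Euc n) : NNReal := ‖fourierTransform f ξ‖₊ ^ 2

theorem measurable_spectralWeight (hf : IsBoundedlySupported f) : Measurable (spectralWeight f) :=
  ((continuous_fourierTransform hf).nnnorm.pow 2).measurable

theorem charFun_withDensity_spectralWeight (hg : IsBoundedlySupported g) (m : Measure (Euc n))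
    (w : Euc n) :
    charFun (m.withDensity fun ξ => (spectralWeight g ξ : ENNReal)) w =
      ∫ ξ, Complex.exp (((inner ℝ ξ w : ℝ) : ℂ) * Complex.I) *
        ((‖fourierTransform g ξ‖ ^ 2 : ℝ) : ℂ) ∂m := by
  rw [charFun_apply, integral_withDensity_eq_integral_smul (measurable_spectralWeight hg)]
  refine integral_congr_ae (.of_forall fun ξ => ?_)
  simp only [spectralWeight, NNReal.smul_def, Complex.real_smul]
  push_cast
  rw [mul_comm]

theorem isFiniteMeasure_withDensity_spectralWeight (g : Euc n → ℂ) (m : Measure (Euc n))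
    [IsFiniteMeasure m] :
    IsFiniteMeasure (m.withDensity fun ξ => (spectralWeight g ξ : ENNReal)) := by
  refine isFiniteMeasure_withDensity (ne_of_lt ?_)
  have hb : ∀ ξ, (spectralWeight g ξ : ENNReal) ≤ ((∫ x, ‖g x‖).toNNReal ^ 2 : NNReal) := by
    intro ξ
    refine ENNReal.coe_le_coe.2 (pow_le_pow_left₀ zero_le ?_ 2)
    exact NNReal.le_toNNReal_of_coe_le (norm_fourierTransform_le g ξ)
  refine (lintegral_mono hb).trans_lt ?_
  rw [lintegral_const]
  exact ENNReal.mul_lt_top ENNReal.coe_lt_top (measure_lt_top _ _)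

/-- The spectral measures of two linear statistics are proportional. -/
theorem withDensity_spectralWeight_comm (hμ : IsLocallySquareIntegrable μ)
    (hf : IsBoundedlySupported f) (hg : IsBoundedlySupported g) {mf mg : Measure (Euc n)}
    [IsFiniteMeasure mf] [IsFiniteMeasure mg]
    (hmf : ∀ v w, statCov μ (shift v f) (shift w f) = charFun mf (w - v))
    (hmg : ∀ v w, statCov μ (shift v g) (shift w g) = charFun mg (w - v)) :
    (mf.withDensity fun ξ => (spectralWeight g ξ : ENNReal)) =
      mg.withDensity fun ξ => (spectralWeight f ξ : ENNReal) := by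
  have := isFiniteMeasure_withDensity_spectralWeight g mf
  have := isFiniteMeasure_withDensity_spectralWeight f mg
  -- Both characteristic functions are the covariance of `f * g` with its translate by `w`, since
  -- convolution commutes.
  refine Measure.ext_of_charFun (funext fun w => ?_)
  rw [charFun_withDensity_spectralWeight hg, charFun_withDensity_spectralWeight hf,
    ← statCov_conv_conv hμ hf hg hmf, ← statCov_conv_conv hμ hg hf hmg, conv_comm]

end RandomMeasure

end

/-! ### Construction and uniqueness of the diffraction measure. -/

noncomputable section

namespace RandomMeasure

open Filter Topology Set

variable {n : ℕ} {f g h : Euc n → ℂ} {μ : Measure (LocFinMeasure n)}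

/-! ### A window function with nowhere vanishing Fourier transform -/

/-- The product of truncated exponentials `e^{-x_i} 1_{[0, 1]}(x_i)`. -/
def expWindow (n : ℕ) (x : Euc n) : ℂ :=
  ∏ i, (Icc (0 : ℝ) 1).indicator (fun t => ((Real.exp (-t) : ℝ) : ℂ)) (x i)

theorem isBoundedlySupported_expWindow (n : ℕ) : IsBoundedlySupported (expWindow n) := by
  refine .of_radius (M := 1) (R := √n) ?_ (fun x => ?_) (fun x hx => ?_)
  · refine Finset.measurable_prod _ fun i _ => ?_
    have h1 : Measurable ((Icc (0 : ℝ) 1).indicator fun t => ((Real.exp (-t) : ℝ) : ℂ)) :=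
      Measurable.indicator (Continuous.measurable (by fun_prop)) measurableSet_Icc
    have h2 : Measurable fun x : Euc n => x i := Continuous.measurable (by fun_prop)
    exact h1.comp h2
  · rw [expWindow, norm_prod]
    refine Finset.prod_le_one (fun i _ => norm_nonneg _) fun i _ => ?_
    by_cases hi : x i ∈ Icc (0 : ℝ) 1
    · rw [indicator_of_mem hi, Complex.norm_real, Real.norm_of_nonneg (Real.exp_pos _).le]
      exact Real.exp_le_one_iff.2 (by linarith [hi.1])
    · rw [indicator_of_notMem hi, norm_zero]
      exact zero_le_one
  · have h1 : ∀ i, x i ∈ Icc (0 : ℝ) 1 := fun i => by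
      by_contra hi
      exact hx (Finset.prod_eq_zero (Finset.mem_univ i) (indicator_of_notMem hi _))
    rw [EuclideanSpace.norm_eq]
    refine Real.sqrt_le_sqrt ?_
    calc ∑ i, ‖x i‖ ^ 2 ≤ ∑ _i : Fin n, (1 : ℝ) := by
          refine Finset.sum_le_sum fun i _ => ?_
          rw [Real.norm_of_nonneg (h1 i).1]
          exact pow_le_one₀ (h1 i).1 (h1 i).2
      _ = n := by simp

/-- The transform factors over coordinates into `(e^{-(1+iξᵢ)} - 1) / (-(1+iξᵢ))`, whose numerator
cannot vanish because `|e^{-(1+iξᵢ)}| = e⁻¹ ≠ 1`. The exponential weight is essential: the transform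
of a plain cube has zeros. -/
theorem fourierTransform_expWindow_ne_zero (ξ : Euc n) : fourierTransform (expWindow n) ξ ≠ 0 := by
  have hprod : fourierTransform (expWindow n) ξ = ∏ i, ∫ t : ℝ,
      (Icc (0 : ℝ) 1).indicator (fun t => ((Real.exp (-t) : ℝ) : ℂ)) t *
        Complex.exp (-(Complex.I * ((t * ξ i : ℝ) : ℂ))) := by
    rw [← integral_fintype_prod_volume_eq_prod (fun i t =>
      (Icc (0 : ℝ) 1).indicator (fun t => ((Real.exp (-t) : ℝ) : ℂ)) t *
        Complex.exp (-(Complex.I * ((t * ξ i : ℝ) : ℂ)))),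
      ← (PiLp.volume_preserving_ofLp (Fin n)).integral_comp
        (MeasurableEquiv.toLp 2 (Fin n → ℝ)).symm.measurableEmbedding]
    refine integral_congr_ae (.of_forall fun x => ?_)
    simp only [expWindow]
    rw [Finset.prod_mul_distrib, ← Complex.exp_sum]
    congr 2
    rw [PiLp.inner_apply, Finset.sum_neg_distrib, ← Finset.mul_sum]
    simp [mul_comm]
  rw [hprod]
  refine Finset.prod_ne_zero_iff.2 fun i _ => ?_
  have hc : -((1 : ℂ) + Complex.I * (ξ i : ℂ)) ≠ 0 := fun h => by
    have := congrArg Complex.re h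
    simp at this
  have hint : ∫ t : ℝ, (Icc (0 : ℝ) 1).indicator (fun t => ((Real.exp (-t) : ℝ) : ℂ)) t *
        Complex.exp (-(Complex.I * ((t * ξ i : ℝ) : ℂ))) =
      ∫ t in (0 : ℝ)..1, Complex.exp (-((1 : ℂ) + Complex.I * (ξ i : ℂ)) * t) := by
    rw [intervalIntegral.integral_of_le zero_le_one, ← integral_Icc_eq_integral_Ioc,
      ← integral_indicator measurableSet_Icc]
    refine integral_congr_ae (.of_forall fun t => ?_)
    by_cases ht : t ∈ Icc (0 : ℝ) 1
    · simp only [indicator_of_mem ht]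
      rw [Complex.ofReal_exp, ← Complex.exp_add]
      congr 1
      push_cast
      ring
    · simp only [indicator_of_notMem ht, zero_mul]
  rw [hint, integral_exp_mul_complex hc]
  refine div_ne_zero (fun h => ?_) hc
  have h1 := congrArg norm (sub_eq_zero.1 h)
  rw [Complex.norm_exp, Complex.norm_exp] at h1
  simp at h1

/-! ### Existence and uniqueness of the diffraction measure -/

theorem spectralWeight_expWindow_ne_zero (ξ : Euc n) : spectralWeight (expWindow n) ξ ≠ 0 :=
  pow_ne_zero 2 (nnnorm_ne_zero_iff.2 (fourierTransform_expWindow_ne_zero ξ))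

theorem lintegral_enorm_sq_fourierTransform (f : Euc n → ℂ) (η : Measure (Euc n)) :
    ∫⁻ ξ, ‖fourierTransform f ξ‖ₑ ^ 2 ∂η =
      η.withDensity (fun ξ => (spectralWeight f ξ : ENNReal)) univ := by
  rw [withDensity_apply _ MeasurableSet.univ, Measure.restrict_univ]
  simp [spectralWeight, enorm_eq_nnnorm]

theorem memLp_fourierTransform_of_isFiniteMeasure (hf : IsBoundedlySupported f)
    {η : Measure (Euc n)}
    (hfin : IsFiniteMeasure (η.withDensity fun ξ => (spectralWeight f ξ : ENNReal))) :
    MemLp (fourierTransform f) 2 η := by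
  refine ⟨(continuous_fourierTransform hf).aestronglyMeasurable, ?_⟩
  rw [eLpNorm_lt_top_iff_lintegral_rpow_enorm_lt_top (by simp) (by simp)]
  simp only [ENNReal.toReal_ofNat, ENNReal.rpow_ofNat]
  rw [lintegral_enorm_sq_fourierTransform]
  exact measure_lt_top _ _

/-- A measure is a diffraction measure as soon as its weighted versions are the spectral measures
of the linear statistics. -/
theorem isDiffractionMeasure_of_forall_spectralMeasure [IsProbabilityMeasure μ]
    (hμ : IsLocallySquareIntegrable μ) {η : Measure (Euc n)} (hη : IsLocallyFiniteMeasure η)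
    (hfin : ∀ f : Euc n → ℂ, IsBoundedlySupported f →
      IsFiniteMeasure (η.withDensity fun ξ => (spectralWeight f ξ : ENNReal)))
    (hchar : ∀ f : Euc n → ℂ, IsBoundedlySupported f → statCov μ f f =
      charFun (η.withDensity fun ξ => (spectralWeight f ξ : ENNReal)) 0) :
    IsDiffractionMeasure μ η := by
  have hmem : ∀ f : Euc n → ℂ, IsBoundedlySupported f → MemLp (fourierTransform f) 2 η :=
    fun f hf => memLp_fourierTransform_of_isFiniteMeasure hf (hfin f hf)
  refine ⟨hη, hmem, fun f g hf hg => ?_⟩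
  have hnorm : ∀ {f : Euc n → ℂ} (hf : IsBoundedlySupported f),
      ‖centeredStat hμ hf‖ = ‖(hmem f hf).toLp‖ := by
    intro f hf
    have h1 := hchar f hf
    rw [statCov_eq_inner hμ hf hf, inner_self_eq_norm_sq_to_K,
      charFun_withDensity_spectralWeight hf] at h1
    have h2 : inner ℂ (hmem f hf).toLp (hmem f hf).toLp = ((‖(hmem f hf).toLp‖ : ℂ)) ^ 2 :=
      inner_self_eq_norm_sq_to_K _
    rw [L2.inner_def] at h2
    have h3 : ∫ ξ, inner ℂ ((hmem f hf).toLp _ ξ) ((hmem f hf).toLp _ ξ) ∂η =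
        ∫ ξ, Complex.exp (((inner ℝ ξ (0 : Euc n) : ℝ) : ℂ) * Complex.I) *
          ((‖fourierTransform f ξ‖ ^ 2 : ℝ) : ℂ) ∂η := by
      refine integral_congr_ae ?_
      filter_upwards [(hmem f hf).coeFn_toLp] with ξ hξ
      rw [hξ, inner_self_eq_norm_sq_to_K]
      simp
    rw [h3, ← h1] at h2
    have h4 : ‖centeredStat hμ hf‖ ^ 2 = ‖(hmem f hf).toLp‖ ^ 2 :=
      Complex.ofReal_injective (by push_cast; exact h2)
    exact (pow_left_inj₀ (norm_nonneg _) (norm_nonneg _) two_ne_zero).1 h4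
  have hadd : ∀ c : ℂ, ‖centeredStat hμ hg + c • centeredStat hμ hf‖ =
      ‖(hmem g hg).toLp + c • (hmem f hf).toLp‖ := by
    intro c
    have hgf := hg.add (hf.const_smul c)
    have e1 : centeredStat hμ hg + c • centeredStat hμ hf = centeredStat hμ hgf := by
      unfold centeredStat
      rw [← MemLp.toLp_const_smul, ← MemLp.toLp_add]
      refine MemLp.toLp_congr _ _ (.of_forall fun p => ?_)
      have h1 : ∀ q : LocFinMeasure n, linearStatistic (g + c • f) q =
          linearStatistic g q + c * linearStatistic f q := fun q => by
        rw [linearStatistic_add hg (hf.const_smul c), linearStatistic_smul]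
      simp_rw [h1]
      rw [integral_add ((memLp_linearStatistic hμ hg).integrable (by norm_num))
        (((memLp_linearStatistic hμ hf).integrable (by norm_num)).const_mul c), integral_const_mul]
      simp only [Pi.add_apply, Pi.smul_apply, smul_eq_mul]
      ring
    have e2 : (hmem g hg).toLp + c • (hmem f hf).toLp = (hmem _ hgf).toLp := by
      rw [← MemLp.toLp_const_smul, ← MemLp.toLp_add]
      refine MemLp.toLp_congr _ _ (.of_forall fun p => ?_)
      rw [fourierTransform_add hg (hf.const_smul c), fourierTransform_smul]
    rw [e1, e2, hnorm]
  -- Polarization: the norms agree on all combinations `g + c f`, hence so do the inner products.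
  have hinner : inner ℂ (centeredStat hμ hg) (centeredStat hμ hf) =
      inner ℂ (hmem g hg).toLp (hmem f hf).toLp := by
    rw [inner_eq_sum_norm_sq_div_four, inner_eq_sum_norm_sq_div_four]
    have h1 := hadd 1
    have h2 := hadd (-1)
    have h3 := hadd RCLike.I
    have h4 := hadd (-RCLike.I)
    simp only [one_smul, neg_smul, ← sub_eq_add_neg] at h1 h2 h3 h4
    rw [h1, h2, h3, h4]
  rw [statCov_eq_inner hμ hf hg, hinner, L2.inner_def]
  refine integral_congr_ae ?_
  filter_upwards [(hmem f hf).coeFn_toLp, (hmem g hg).coeFn_toLp] with ξ h1 h2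
  rw [h1, h2, RCLike.inner_apply]

theorem measurable_coe_inv_spectralWeight (hf : IsBoundedlySupported f) :
    Measurable fun ξ => (((spectralWeight f ξ)⁻¹ : NNReal) : ENNReal) :=
  (measurable_spectralWeight hf).inv.coe_nnreal_ennreal

theorem withDensity_withDensity_inv_spectralWeight (m : Measure (Euc n)) :
    (m.withDensity fun ξ => (spectralWeight (expWindow n) ξ : ENNReal)).withDensity
      (fun ξ => (((spectralWeight (expWindow n) ξ)⁻¹ : NNReal) : ENNReal)) = m := by
  have hm := measurable_spectralWeight (isBoundedlySupported_expWindow n)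
  rw [← withDensity_mul _ hm.coe_nnreal_ennreal
    (measurable_coe_inv_spectralWeight (isBoundedlySupported_expWindow n))]
  have : ((fun ξ => (spectralWeight (expWindow n) ξ : ENNReal)) *
      fun ξ => (((spectralWeight (expWindow n) ξ)⁻¹ : NNReal) : ENNReal)) = 1 := by
    ext ξ
    rw [Pi.mul_apply, ← ENNReal.coe_mul, mul_inv_cancel₀ (spectralWeight_expWindow_ne_zero ξ)]
    simp
  rw [this, withDensity_one]

/-- The measure is `|ŵ|⁻² m_w` for the window `w`. Its density is continuous because `ŵ` has no
zeros, which gives local finiteness; the comparison of spectral measures gives `|f̂|² η = m_f` for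
every `f`. -/
theorem exists_isDiffractionMeasure [IsProbabilityMeasure μ] (hi : IsInvariant μ)
    (hμ : IsLocallySquareIntegrable μ) : ∃ η, IsDiffractionMeasure μ η := by
  have hw := isBoundedlySupported_expWindow n
  obtain ⟨m, hmfin, hm⟩ := exists_spectralMeasure hμ hi hw
  set η := m.withDensity fun ξ => (((spectralWeight (expWindow n) ξ)⁻¹ : NNReal) : ENNReal) with hη
  have key : ∀ f : Euc n → ℂ, IsBoundedlySupported f → ∀ mf : Measure (Euc n), IsFiniteMeasure mf →
      (∀ v w, statCov μ (shift v f) (shift w f) = charFun mf (w - v)) →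
      (η.withDensity fun ξ => (spectralWeight f ξ : ENNReal)) = mf := by
    intro f hf mf hmf hchar
    have h1 := withDensity_spectralWeight_comm hμ hw hf hm hchar
    rw [hη, ← withDensity_mul _ (measurable_coe_inv_spectralWeight hw)
      (measurable_spectralWeight hf).coe_nnreal_ennreal, mul_comm,
      withDensity_mul _ (measurable_spectralWeight hf).coe_nnreal_ennreal
        (measurable_coe_inv_spectralWeight hw), h1, withDensity_withDensity_inv_spectralWeight]
  refine ⟨η, isDiffractionMeasure_of_forall_spectralMeasure hμ ⟨fun x => ?_⟩ (fun f hf => ?_)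
    fun f hf => ?_⟩
  · have hc : Continuous fun ξ => (spectralWeight (expWindow n) ξ)⁻¹ :=
      ((continuous_fourierTransform hw).nnnorm.pow 2).inv₀ spectralWeight_expWindow_ne_zero
    have := IsLocallyFiniteMeasure.withDensity_coe (μ := m) hc
    exact this.finiteAtNhds x
  · obtain ⟨mf, hmf, hchar⟩ := exists_spectralMeasure hμ hi hf
    rw [key f hf mf hmf hchar]
    exact hmf
  · obtain ⟨mf, hmf, hchar⟩ := exists_spectralMeasure hμ hi hf
    rw [key f hf mf hmf hchar]
    have := hchar 0 0
    rwa [shift_zero, sub_zero] at this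

/-- Testing on the window and its translates determines the characteristic function of the finite
measure `|ŵ|² η`, and the nonvanishing density can be inverted. -/
theorem IsDiffractionMeasure.eq {η η' : Measure (Euc n)} (h : IsDiffractionMeasure μ η)
    (h' : IsDiffractionMeasure μ η') : η = η' := by
  have hw := isBoundedlySupported_expWindow n
  have hfin : ∀ {η : Measure (Euc n)}, IsDiffractionMeasure μ η →
      IsFiniteMeasure (η.withDensity fun ξ => (spectralWeight (expWindow n) ξ : ENNReal)) := by
    intro η h
    refine ⟨?_⟩
    rw [← lintegral_enorm_sq_fourierTransform]
    have := (eLpNorm_lt_top_iff_lintegral_rpow_enorm_lt_top (by simp) (by simp)).1 (h.memLp _ hw).2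
    simpa only [ENNReal.toReal_ofNat, ENNReal.rpow_ofNat] using this
  have hchar : ∀ {η : Measure (Euc n)}, IsDiffractionMeasure μ η → ∀ w,
      charFun (η.withDensity fun ξ => (spectralWeight (expWindow n) ξ : ENNReal)) w =
        statCov μ (expWindow n) (shift w (expWindow n)) := by
    intro η h w
    rw [charFun_withDensity_spectralWeight hw, h.cov_eq _ _ hw (hw.shift w)]
    refine integral_congr_ae (.of_forall fun ξ => ?_)
    simp only [fourierTransform_shift, map_mul, ← Complex.exp_conj, map_neg, Complex.conj_I,
      Complex.conj_ofReal]
    rw [mul_left_comm, Complex.mul_conj, Complex.normSq_eq_norm_sq, real_inner_comm]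
    congr 2
    ring
  have := hfin h
  have := hfin h'
  rw [← withDensity_withDensity_inv_spectralWeight η, ← withDensity_withDensity_inv_spectralWeight η',
    Measure.ext_of_charFun (funext fun w => (hchar h w).trans (hchar h' w).symm)]

end RandomMeasure

end

/-! ### The averaged number variance. -/

noncomputable section

namespace RandomMeasure

open Filter Topology Set

variable {n : ℕ} {μ : Measure (LocFinMeasure n)}

theorem linearStatistic_indicator_ball (r : ℝ) (p : LocFinMeasure n) :
    linearStatistic ((Metric.ball (0 : Euc n) r).indicator 1) p =
      (p.1.real (Metric.ball (0 : Euc n) r) : ℂ) := by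
  rw [linearStatistic, integral_indicator Metric.isOpen_ball.measurableSet]
  simp

theorem memLp_measureReal_ball (hμ : IsLocallySquareIntegrable μ) (r : ℝ) :
    MemLp (fun p : LocFinMeasure n => p.1.real (Metric.ball (0 : Euc n) r)) 2 μ :=
  memLp_measureReal hμ Metric.isOpen_ball.measurableSet Metric.isBounded_ball

/-- The variance is a difference of two functions of `r`, the second moment and the squared mean,
and each is monotone because balls are nested. -/
theorem intervalIntegrable_numberVariance [IsProbabilityMeasure μ]
    (hμ : IsLocallySquareIntegrable μ) (a b : ℝ) :
    IntervalIntegrable (numberVariance μ) volume a b := by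
  have hmono : ∀ p : LocFinMeasure n,
      Monotone fun r : ℝ => p.1.real (Metric.ball (0 : Euc n) r) := fun p r s hrs =>
    measureReal_mono (Metric.ball_subset_ball hrs)
      (measure_lt_top_of_isBounded p Metric.isBounded_ball).ne
  have h1 : Monotone fun r : ℝ =>
      ∫ p : LocFinMeasure n, p.1.real (Metric.ball (0 : Euc n) r) ∂μ := fun r s hrs =>
    integral_mono ((memLp_measureReal_ball hμ r).integrable (by norm_num))
      ((memLp_measureReal_ball hμ s).integrable (by norm_num)) fun p => hmono p hrs
  have h2 : Monotone fun r : ℝ =>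
      ∫ p : LocFinMeasure n, p.1.real (Metric.ball (0 : Euc n) r) ^ 2 ∂μ := fun r s hrs =>
    integral_mono (memLp_measureReal_ball hμ r).integrable_sq
      (memLp_measureReal_ball hμ s).integrable_sq fun p =>
        pow_le_pow_left₀ measureReal_nonneg (hmono p hrs) 2
  have h3 : Monotone fun r : ℝ =>
      (∫ p : LocFinMeasure n, p.1.real (Metric.ball (0 : Euc n) r) ∂μ) ^ 2 := fun r s hrs =>
    pow_le_pow_left₀ (integral_nonneg fun p => measureReal_nonneg) (h1 hrs) 2
  have heq : numberVariance μ = (fun r : ℝ =>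
      ∫ p : LocFinMeasure n, p.1.real (Metric.ball (0 : Euc n) r) ^ 2 ∂μ) - fun r : ℝ =>
      (∫ p : LocFinMeasure n, p.1.real (Metric.ball (0 : Euc n) r) ∂μ) ^ 2 := by
    ext r
    exact variance_eq_sub (memLp_measureReal_ball hμ r)
  rw [heq]
  exact h2.intervalIntegrable.sub h3.intervalIntegrable

theorem numberVariance_nonneg (μ : Measure (LocFinMeasure n)) (r : ℝ) : 0 ≤ numberVariance μ r :=
  variance_nonneg _ _

/-- The number variance in terms of the diffraction measure. -/
theorem ofReal_numberVariance (hμ : IsLocallySquareIntegrable μ) {η : Measure (Euc n)}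
    (hη : IsDiffractionMeasure μ η) (r : ℝ) :
    ENNReal.ofReal (numberVariance μ r) =
      ∫⁻ ξ, ENNReal.ofReal
        (‖fourierTransform ((Metric.ball (0 : Euc n) r).indicator 1) ξ‖ ^ 2) ∂η := by
  have hf := IsBoundedlySupported.indicator_ball (n := n) r
  have h1 : statCov μ ((Metric.ball (0 : Euc n) r).indicator 1)
      ((Metric.ball (0 : Euc n) r).indicator 1) = (numberVariance μ r : ℂ) := by
    rw [numberVariance, variance_eq_integral (memLp_measureReal_ball hμ r).aemeasurable,
      ← integral_complex_ofReal, statCov]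
    refine integral_congr_ae (.of_forall fun p => ?_)
    simp only [linearStatistic_indicator_ball, integral_complex_ofReal, map_sub,
      Complex.conj_ofReal]
    push_cast
    ring
  have h2 : ((∫ ξ, ‖fourierTransform ((Metric.ball (0 : Euc n) r).indicator 1) ξ‖ ^ 2 ∂η : ℝ) : ℂ)
      = (numberVariance μ r : ℂ) := by
    rw [← h1, hη.cov_eq _ _ hf hf, ← integral_complex_ofReal]
    refine integral_congr_ae (.of_forall fun ξ => ?_)
    simp only []
    rw [Complex.mul_conj, Complex.normSq_eq_norm_sq]
  rw [← Complex.ofReal_injective h2, ofReal_integral_eq_lintegral_ofReal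
    (hη.memLp _ hf).norm.integrable_sq (.of_forall fun ξ => sq_nonneg _)]

/-- Mean-square lower bound for the Fourier transforms of balls at a frequency of norm `s`. -/
theorem integral_sphericalCos_scaled_lower_bound {m : ℕ} {C : ℝ}
    (hC : ∀ T : ℝ, 1 ≤ T →
      C * T ^ (m + 1) ≤ ∫ s in (0 : ℝ)..T, s ^ (2 * m + 2) * sphericalCos m s ^ 2)
    {R s : ℝ} (hs : 0 < s) (hRs : 1 ≤ R * s) :
    C * R ^ (m + 1) * (1 / s ^ (m + 2)) ≤
      ∫ r in (0 : ℝ)..R, (r ^ (m + 1) * sphericalCos m (r * s)) ^ 2 := by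
  -- Under `t = rs` the powers combine as `s^-(2m+2) · s⁻¹ · (Rs)^(m+1) = R^(m+1) s^-(m+2)`.
  have h1 := intervalIntegral.integral_comp_mul_right (a := 0) (b := R)
    (fun t => t ^ (2 * m + 2) * sphericalCos m t ^ 2) hs.ne'
  have h2 : ∫ r in (0 : ℝ)..R, (r ^ (m + 1) * sphericalCos m (r * s)) ^ 2 =
      (s ^ (2 * m + 2))⁻¹ * ∫ r in (0 : ℝ)..R, (r * s) ^ (2 * m + 2) * sphericalCos m (r * s) ^ 2 := by
    rw [← intervalIntegral.integral_const_mul]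
    refine intervalIntegral.integral_congr fun r _ => ?_
    have : s ^ (2 * m + 2) ≠ 0 := by positivity
    simp only [mul_pow]
    rw [← pow_mul, show (m + 1) * 2 = 2 * m + 2 by ring]
    field_simp
  rw [h2, h1, zero_mul, smul_eq_mul]
  calc C * R ^ (m + 1) * (1 / s ^ (m + 2))
      = (s ^ (2 * m + 2))⁻¹ * (s⁻¹ * (C * (R * s) ^ (m + 1))) := by
        rw [mul_pow, show 2 * m + 2 = (m + 1) + (m + 1) by ring, pow_add,
          show m + 2 = (m + 1) + 1 by ring, pow_succ s (m + 1)]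
        field_simp
        ring
    _ ≤ _ := by
        gcongr
        exact hC _ hRs

/-- The one-variable bound is applied frequency by frequency, followed by Tonelli. Working with
extended nonnegative integrals avoids presupposing that the left side is finite; finiteness becomes
a consequence. -/
theorem lintegral_le_ofReal_integral_numberVariance {m : ℕ} {μ : Measure (LocFinMeasure (m + 1))}
    [IsProbabilityMeasure μ] (hμ : IsLocallySquareIntegrable μ) {η : Measure (Euc (m + 1))}
    (hη : IsDiffractionMeasure μ η) {C : ℝ}
    (hC : ∀ T : ℝ, 1 ≤ T →
      C * T ^ (m + 1) ≤ ∫ s in (0 : ℝ)..T, s ^ (2 * m + 2) * sphericalCos m s ^ 2)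
    (hC0 : 0 < C) {R₀ R : ℝ} (hR₀ : 0 < R₀) (hR : R₀ ≤ R) :
    ENNReal.ofReal (volume.real (Metric.ball (0 : Euc m) 1) ^ 2 * (C * R ^ (m + 1))) *
        ∫⁻ ξ in {ξ : Euc (m + 1) | 1 / R₀ ≤ ‖ξ‖}, ENNReal.ofReal (1 / ‖ξ‖ ^ (m + 2)) ∂η ≤
      ENNReal.ofReal (∫ r in (0 : ℝ)..R, numberVariance μ r) := by
  have := hη.locallyFinite
  set κ := volume.real (Metric.ball (0 : Euc m) 1) with hκ
  have hRpos : 0 < R := hR₀.trans_le hR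
  have hsc := continuous_sphericalCos m
  set A : Set (Euc (m + 1)) := {ξ | 1 / R₀ ≤ ‖ξ‖} with hA
  have hAm : MeasurableSet A := (isClosed_le continuous_const continuous_norm).measurableSet
  have hnv := (intervalIntegrable_iff_integrableOn_Ioc_of_le hRpos.le).1
    (intervalIntegrable_numberVariance hμ 0 R)
  have hFc : Continuous fun q : ℝ × Euc (m + 1) =>
      (κ * (q.1 ^ (m + 1) * sphericalCos m (q.1 * ‖q.2‖))) ^ 2 := by fun_prop
  calc ENNReal.ofReal (κ ^ 2 * (C * R ^ (m + 1))) * ∫⁻ ξ in A, ENNReal.ofReal (1 / ‖ξ‖ ^ (m + 2)) ∂η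
      = ∫⁻ ξ in A, ENNReal.ofReal (κ ^ 2 * (C * R ^ (m + 1) * (1 / ‖ξ‖ ^ (m + 2)))) ∂η := by
        rw [← lintegral_const_mul' _ _ ENNReal.ofReal_ne_top]
        refine lintegral_congr fun ξ => ?_
        rw [← ENNReal.ofReal_mul (by positivity)]
        ring_nf
    _ ≤ ∫⁻ ξ in A, (∫⁻ r in Ioc 0 R,
          ENNReal.ofReal ((κ * (r ^ (m + 1) * sphericalCos m (r * ‖ξ‖))) ^ 2)) ∂η := by
        refine setLIntegral_mono' hAm fun ξ hξ => ?_
        have hξ' : 1 / R₀ ≤ ‖ξ‖ := hξ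
        have hs : 0 < ‖ξ‖ := lt_of_lt_of_le (by positivity) hξ'
        have hRs : 1 ≤ R * ‖ξ‖ := by
          calc 1 = R₀ * (1 / R₀) := by field_simp
            _ ≤ R * ‖ξ‖ := by gcongr
        have hcont : Continuous fun r : ℝ => (κ * (r ^ (m + 1) * sphericalCos m (r * ‖ξ‖))) ^ 2 := by
          fun_prop
        have hint : IntegrableOn (fun r : ℝ => (κ * (r ^ (m + 1) * sphericalCos m (r * ‖ξ‖))) ^ 2)
            (Ioc 0 R) := hcont.integrableOn_Ioc
        rw [← ofReal_integral_eq_lintegral_ofReal hint (.of_forall fun r => sq_nonneg _),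
          ← intervalIntegral.integral_of_le hRpos.le]
        refine ENNReal.ofReal_le_ofReal ?_
        simp_rw [mul_pow κ]
        rw [intervalIntegral.integral_const_mul]
        gcongr
        exact integral_sphericalCos_scaled_lower_bound hC hs hRs
    _ ≤ ∫⁻ ξ, (∫⁻ r in Ioc 0 R,
          ENNReal.ofReal ((κ * (r ^ (m + 1) * sphericalCos m (r * ‖ξ‖))) ^ 2)) ∂η :=
        setLIntegral_le_lintegral _ _
    _ = ∫⁻ r in Ioc 0 R, ∫⁻ ξ,
          ENNReal.ofReal ((κ * (r ^ (m + 1) * sphericalCos m (r * ‖ξ‖))) ^ 2) ∂η :=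
        (lintegral_lintegral_swap (f := fun r ξ =>
          ENNReal.ofReal ((κ * (r ^ (m + 1) * sphericalCos m (r * ‖ξ‖))) ^ 2))
          hFc.measurable.ennreal_ofReal.aemeasurable).symm
    _ ≤ ∫⁻ r in Ioc 0 R, ENNReal.ofReal (numberVariance μ r) := by
        refine setLIntegral_mono' measurableSet_Ioc fun r hr => ?_
        rw [ofReal_numberVariance hμ hη]
        refine lintegral_mono fun ξ => ENNReal.ofReal_le_ofReal ?_
        rw [hκ, ← re_fourierTransform_indicator_ball m hr.1 ξ, ← sq_abs]
        gcongr
        exact Complex.abs_re_le_norm _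
    _ = ENNReal.ofReal (∫ r in (0 : ℝ)..R, numberVariance μ r) := by
        rw [intervalIntegral.integral_of_le hRpos.le,
          ofReal_integral_eq_lintegral_ofReal hnv (.of_forall fun r => numberVariance_nonneg μ r)]

end RandomMeasure

end

/-! ### The main theorem. -/

theorem mainTheorem2 (n : ℕ) (hn : 1 ≤ n) :
    ∃ C : ℝ, 0 < C ∧
      ∀ μ : Measure (RandomMeasure.LocFinMeasure n), IsProbabilityMeasure μ →
        RandomMeasure.IsInvariant μ → RandomMeasure.IsLocallySquareIntegrable μ →
        (∃! η : Measure (RandomMeasure.Euc n), RandomMeasure.IsDiffractionMeasure μ η) ∧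
        ∀ η : Measure (RandomMeasure.Euc n), RandomMeasure.IsDiffractionMeasure μ η →
          ∀ R₀ : ℝ, 0 < R₀ →
            IntegrableOn (fun ξ : RandomMeasure.Euc n => 1 / ‖ξ‖ ^ (n + 1))
              {ξ | 1 / R₀ ≤ ‖ξ‖} η ∧
            ∀ R : ℝ, R₀ ≤ R →
              IntervalIntegrable (RandomMeasure.numberVariance μ) volume 0 R ∧
              C * (∫ ξ in {ξ : RandomMeasure.Euc n | 1 / R₀ ≤ ‖ξ‖}, 1 / ‖ξ‖ ^ (n + 1) ∂η)
                  * R ^ (n - 1) ≤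
                (1 / R) * ∫ r in (0 : ℝ)..R, RandomMeasure.numberVariance μ r := by
  obtain ⟨m, rfl⟩ : ∃ m, n = m + 1 := ⟨n - 1, by omega⟩
  obtain ⟨C, hC0, hC⟩ := sphericalCos_integral_sq_lower_bound m
  have hκ : 0 < volume.real (Metric.ball (0 : RandomMeasure.Euc m) 1) :=
    ENNReal.toReal_pos (Metric.measure_ball_pos _ _ one_pos).ne' measure_ball_lt_top.ne
  refine ⟨volume.real (Metric.ball (0 : RandomMeasure.Euc m) 1) ^ 2 * C, by positivity,
    fun μ _ hi hμ => ⟨?_, fun η hη R₀ hR₀ => ?_⟩⟩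
  · obtain ⟨η, hη⟩ := RandomMeasure.exists_isDiffractionMeasure hi hμ
    exact ⟨η, hη, fun η' hη' => hη'.eq hη⟩
  have hmain := fun R (hR : R₀ ≤ R) =>
    RandomMeasure.lintegral_le_ofReal_integral_numberVariance hμ hη hC hC0 hR₀ hR
  have hmeas : Measurable fun ξ : RandomMeasure.Euc (m + 1) => 1 / ‖ξ‖ ^ (m + 2) := by fun_prop
  have hint : IntegrableOn (fun ξ : RandomMeasure.Euc (m + 1) => 1 / ‖ξ‖ ^ (m + 2))
      {ξ | 1 / R₀ ≤ ‖ξ‖} η := by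
    refine ⟨hmeas.aestronglyMeasurable, ?_⟩
    rw [hasFiniteIntegral_iff_ofReal (.of_forall fun ξ => by positivity)]
    -- The case `R = R₀` of the inequality already forces finiteness, as its right side is finite
    -- and the prefactor is positive.
    exact ENNReal.lt_top_of_mul_ne_top_right
      ((hmain R₀ le_rfl).trans_lt ENNReal.ofReal_lt_top).ne
      (ENNReal.ofReal_pos.2 (by positivity)).ne'
  refine ⟨hint, fun R hR => ⟨RandomMeasure.intervalIntegrable_numberVariance hμ 0 R, ?_⟩⟩
  have hRpos : 0 < R := hR₀.trans_le hR
  have h1 := hmain R hR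
  rw [← ofReal_integral_eq_lintegral_ofReal hint (.of_forall fun ξ => by positivity),
    ← ENNReal.ofReal_mul (by positivity), ENNReal.ofReal_le_ofReal_iff
      (intervalIntegral.integral_nonneg hRpos.le fun r _ =>
        RandomMeasure.numberVariance_nonneg μ r)] at h1
  rw [one_div_mul_eq_div, le_div_iff₀ hRpos, Nat.add_sub_cancel]
  refine le_trans (le_of_eq ?_) h1
  rw [pow_succ R m]
  ring
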